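/- There are $m\ge 1$ items and $n\ge 1$ bidders. Bidder $i$ has values $v_i=(v_{i1},\dots,v_{im})\in[0,\infty)^m$ and the additive valuation $v_i(S)=\sum_{j\in S}v_{ij}$; all $v_{ij}$ are independent and $v_{ij}\sim F_j$. Write $F=F_1\times\cdots\times F_m$. A probability distribution $G$ on $[0,\infty)$ is called regular if it is carried by an interval $I\subseteq[0,\infty)$ (bounded or not) on which it has a positive density $g$, except that the greatest element of $I$, if there is one, may be an atom, and the virtual value $\varphi(x)=x-\frac{1-G(x)}{g(x)}$ is nondecreasing on $I$ (with $\varphi(b)=b$ at a greatest element $b$ of $I$). The class "$m$ independent, regular items" consists of all $F$ with $F_1,\dots,F_m$ regular. A mechanism maps every bid profile to a lottery over allocations of the items (each item goes to at most one bidder or stays unsold) and to an expected payment of each bidder; the expectations of the payments that occur below are assumed to exist (interim payments are finite, and the expected payment of each bidder is well defined in $(-\infty,\infty]$). The mechanism is BIC if, for every bidder and every type in the support of $F$, when the other bidders' types are drawn from $F$ and reported truthfully, reporting one's true type maximizes expected utility among all reports in the support; it is BIR if the expected utility of truthful reporting is nonnegative for every type in the support. $\mathrm{OPT}(F,n)$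 is the supremum of the expected revenue over all BIC and BIR mechanisms for $n$ bidders with types drawn i.i.d. from $F$. $\mathrm{Rev}(\mathrm{VCG},F,k)$ is the expected revenue of the VCG mechanism (a welfare-maximizing allocation, each bidder paying her externality on the others) for $k$ bidders with types drawn i.i.d. from $F$. The competition complexity $C(n,m)$ is the least $c\in\{0,1,2,\dots\}$ (or $\infty$ if there is none) such that $\mathrm{OPT}(F,n)\le\mathrm{Rev}(\mathrm{VCG},F,n+c)$ for all $F$ in the class of $m$ independent, regular items. Theorem. (1) For all $n,m\ge1$ and all $F=F_1\times\cdots\times F_m$ with regular $F_j$, $$\mathrm{OPT}(F,n)\le\mathrm{Rev}(\mathrm{VCG},F,n+(n+2m-2)),$$ and $C(n,m)\le n+2m-2$. (2) $C(n,m)=\Omega(\log m)$: there is an absolute constant $c>0$ such that for every $n\ge1$ we have $C(n,m)\ge c\log m$ for all sufficiently large $m$ (how large may depend on $n$). -/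

import Mathlib

open MeasureTheory
open scoped ENNReal

namespace Auction

/-! ### Regular one-dimensional distributions -/

/-- Myerson's virtual value `φ(x) = x - (1 - F(x)) / f(x)`, where `F` is the distribution function
of `μ` and `f` is its density. -/
noncomputable def virtualValue (μ : Measure ℝ) (f : ℝ → ℝ) (x : ℝ) : ℝ :=
  x - (1 - μ.real (Set.Iic x)) / f x

/-- A regular distribution of a nonnegative value: a probability measure carried by an interval
`I ⊆ [0, ∞)` (bounded or not, with or without its endpoints), which has a positive density `f` on
`I`, except that the greatest element `b` of `I`, if there is one, may be an atom (of mass `α`),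
and whose virtual value is nondecreasing on `I`. (At a greatest element `b`, atom or not,
`1 - F(b) = 0` and `φ(b) = b`.) -/
def IsRegular (μ : Measure ℝ) : Prop :=
  IsProbabilityMeasure μ ∧
  ∃ (I : Set ℝ) (f : ℝ → ℝ) (α : ℝ≥0∞) (b : ℝ),
    I.OrdConnected ∧ I ⊆ Set.Ici 0 ∧
    Measurable f ∧ (∀ x ∈ I, 0 < f x) ∧
    (α ≠ 0 → IsGreatest I b) ∧
    μ = (volume.restrict I).withDensity (fun x => ENNReal.ofReal (f x)) + α • Measure.dirac b ∧
    MonotoneOn (virtualValue μ f) I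

/-! ### Bidders, allocations, distributions -/

/-- A type of a bidder (her values for the `m` items). -/
abbrev BidderType (m : ℕ) : Type := Fin m → ℝ

/-- A profile of types (or of bids) of `n` bidders. -/
abbrev Profile (n m : ℕ) : Type := Fin n → BidderType m

/-- A deterministic allocation: every item goes to at most one bidder (`none` = unsold). -/
abbrev Allocation (n m : ℕ) : Type := Fin m → Option (Fin n)

/-- The set of items that bidder `i` receives. -/
def bundle {n m : ℕ} (a : Allocation n m) (i : Fin n) : Finset (Fin m) :=
  Finset.univ.filter (fun j => a j = some i)

/-- The additive valuation of a set of items. -/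
def additiveValue {m : ℕ} (v : BidderType m) (S : Finset (Fin m)) : ℝ :=
  ∑ j ∈ S, v j

/-- The distribution of one bidder's type: independent items. -/
noncomputable def typeDist {m : ℕ} (F : Fin m → Measure ℝ) : Measure (BidderType m) :=
  Measure.pi F

/-- The distribution of the profile of `n` i.i.d. bidders. -/
noncomputable def profileDist {m : ℕ} (F : Fin m → Measure ℝ) (n : ℕ) : Measure (Profile n m) :=
  Measure.pi (fun _ => typeDist F)

/-- The type space of a bidder: the product of the supports of the item distributions. -/
def typeSpace {m : ℕ} (F : Fin m → Measure ℝ) : Set (BidderType m) :=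
  {v | ∀ j, v j ∈ (F j).support}

/-! ### Mechanisms -/

/-- A (possibly randomized) direct mechanism for `n` bidders and `m` items: for every profile of
bids a lottery over allocations, and for every bidder the expected payment, given the bids, over
the randomness of the mechanism (a payment may be negative). -/
structure Mechanism (n m : ℕ) where
  lottery : Profile n m → Allocation n m → ℝ
  payment : Profile n m → Fin n → ℝ
  lottery_mem : ∀ b, lottery b ∈ stdSimplex ℝ (Allocation n m)
  measurable_lottery : ∀ a, Measurable (fun b => lottery b a)
  measurable_payment : ∀ i, Measurable (fun b => payment b i)

namespace Mechanism

variable {n m : ℕ}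

/-- Expected value, over the lottery, of bidder `i` with true type `v` when the bids are `b`. -/
noncomputable def expectedValue (M : Mechanism n m) (i : Fin n) (v : BidderType m)
    (b : Profile n m) : ℝ :=
  ∑ a, M.lottery b a * additiveValue v (bundle a i)

/-- Interim expected utility of bidder `i` of true type `v` who reports `r`, when the other bidders
report their types truthfully. (Coordinate `i` of the random profile `w` is overwritten by the
report, so the expectation is over the types of the other bidders.) -/
noncomputable def interimUtility (M : Mechanism n m) (F : Fin m → Measure ℝ) (i : Fin n)
    (v r : BidderType m) : ℝ :=
  ∫ w, (M.expectedValue i v (Function.update w i r) - M.payment (Function.update w i r) i)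
    ∂(profileDist F n)

/-- The expectations that enter the definitions of utility and revenue exist: every interim payment
is a convergent integral, and the expected payment of every bidder is well defined in
`(-∞, ∞]`. -/
def HasExpectedPayments (M : Mechanism n m) (F : Fin m → Measure ℝ) : Prop :=
  (∀ i, ∀ r ∈ typeSpace F,
    Integrable (fun w => M.payment (Function.update w i r) i) (profileDist F n)) ∧
  (∀ i, ∫⁻ w, ENNReal.ofReal (-(M.payment w i)) ∂(profileDist F n) ≠ ∞)

/-- Bayesian incentive compatibility. -/
def IsBIC (M : Mechanism n m) (F : Fin m → Measure ℝ) : Prop :=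
  ∀ i, ∀ v ∈ typeSpace F, ∀ r ∈ typeSpace F,
    M.interimUtility F i v r ≤ M.interimUtility F i v v

/-- Bayesian individual rationality. -/
def IsBIR (M : Mechanism n m) (F : Fin m → Measure ℝ) : Prop :=
  ∀ i, ∀ v ∈ typeSpace F, 0 ≤ M.interimUtility F i v v

/-- The expected revenue: the sum over the bidders of the expected payments, each of them
`E[p⁺] - E[p⁻]`. -/
noncomputable def revenue (M : Mechanism n m) (F : Fin m → Measure ℝ) : EReal :=
  ∑ i, (((∫⁻ w, ENNReal.ofReal (M.payment w i) ∂(profileDist F n) : ℝ≥0∞) : EReal) -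
    ((∫⁻ w, ENNReal.ofReal (-(M.payment w i)) ∂(profileDist F n) : ℝ≥0∞) : EReal))

end Mechanism

/-- The optimal revenue of a BIC and BIR mechanism for `n` i.i.d. additive bidders. -/
noncomputable def optRevenue {m : ℕ} (F : Fin m → Measure ℝ) (n : ℕ) : EReal :=
  ⨆ (M : Mechanism n m) (_ : M.HasExpectedPayments F ∧ M.IsBIC F ∧ M.IsBIR F), M.revenue F

/-! ### The VCG mechanism -/

section VCG

variable {k m : ℕ}

/-- Welfare of an allocation. -/
def welfare (b : Profile k m) (a : Allocation k m) : ℝ :=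
  ∑ i, additiveValue (b i) (bundle a i)

/-- Welfare, in an allocation, of all bidders but `i`. -/
def othersWelfare (b : Profile k m) (i : Fin k) (a : Allocation k m) : ℝ :=
  ∑ i' ∈ Finset.univ.erase i, additiveValue (b i') (bundle a i')

/-- An allocation is efficient if it maximizes welfare. -/
def IsEfficient (b : Profile k m) (a : Allocation k m) : Prop :=
  ∀ a', welfare b a' ≤ welfare b a

theorem exists_isEfficient (b : Profile k m) : ∃ a, IsEfficient b a :=
  Finite.exists_max (welfare b)

/-- The efficient allocation chosen by VCG. The rule that breaks ties does not matter for the total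
payment, by `sum_clarkePayment_eq`. -/
noncomputable def vcgAllocation (b : Profile k m) : Allocation k m :=
  (exists_isEfficient b).choose

/-- Clarke payment of bidder `i` in allocation `a`: her externality, i.e. the greatest welfare that
the others could have without her, minus their welfare in `a`. -/
noncomputable def clarkePayment (b : Profile k m) (a : Allocation k m) (i : Fin k) : ℝ :=
  (⨆ a', othersWelfare b i a') - othersWelfare b i a

theorem sum_clarkePayment_eq (b : Profile k m) (a a' : Allocation k m)
    (ha : IsEfficient b a) (ha' : IsEfficient b a') :
    ∑ i, clarkePayment b a i = ∑ i, clarkePayment b a' i := by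
  have h : ∀ c : Allocation k m, ∀ i, othersWelfare b i c =
      welfare b c - additiveValue (b i) (bundle c i) := by
    intro c i
    have := Finset.add_sum_erase Finset.univ
      (fun i' => additiveValue (b i') (bundle c i')) (Finset.mem_univ i)
    simp only [othersWelfare, welfare]
    linarith
  have hw : welfare b a = welfare b a' := le_antisymm (ha' a) (ha a')
  have hs : ∀ c : Allocation k m, ∑ i, additiveValue (b i) (bundle c i) = welfare b c :=
    fun _ => rfl
  simp only [clarkePayment, h, Finset.sum_sub_distrib, hs, hw]

/-- Expected revenue of VCG, played by `k` i.i.d. additive bidders. -/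
noncomputable def vcgRevenue (F : Fin m → Measure ℝ) (k : ℕ) : ℝ≥0∞ :=
  ∫⁻ b, ENNReal.ofReal (∑ i, clarkePayment b (vcgAllocation b) i) ∂(profileDist F k)

end VCG

/-! ### Competition complexity -/

/-- `VCG` with `c` extra bidders earns at least the optimal revenue of `n` bidders, for every
distribution in the class `D`. -/
def Suffices {m : ℕ} (D : Set (Fin m → Measure ℝ)) (n c : ℕ) : Prop :=
  ∀ F ∈ D, optRevenue F n ≤ ((vcgRevenue F (n + c) : ℝ≥0∞) : EReal)

/-- The competition complexity of `n` additive bidders and a class `D` of distributions: the least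
sufficient number of extra bidders (`⊤` if there is none). -/
noncomputable def competitionComplexity {m : ℕ} (D : Set (Fin m → Measure ℝ)) (n : ℕ) : ℕ∞ :=
  ⨅ (c : ℕ) (_ : Suffices D n c), (c : ℕ∞)

/-- The class "`m` independent, regular items". -/
def regularItems (m : ℕ) : Set (Fin m → Measure ℝ) :=
  {F | ∀ j, IsRegular (F j)}

end Auction

namespace Auction

/-! ### Resampling coordinates of product measures -/

section Product

variable {ι κ : Type*}

/-! Upper bound. Values are quantile functions of independent uniform samples. A bidder pays her
expected value minus her utility, and incentive compatibility makes her share of an item a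
subgradient of her utility. So her utility is at least the information rent from any single item.
Take her favorite, the one with the highest quantile, and count the rent from the quantile at which
it stops being the favorite (`ofReal_interimPayment_le`). Integrating over that item's quantile
turns value minus rent into virtual value (`lintegral_payment_le`). As an item is sold at most once,
it earns at most the expected maximum, over the bidders, of the positive part of a contribution: the
virtual value for a bidder whose favorite it is, the value for the others
(`sum_lintegral_benchmark_le`).

Fix an item and let bidder i have the highest quantile for it. Consider the N = n + m - 1 samples
formed by all quantiles for this item and the other quantiles of i. Every contribution is at most
max(φ(highest), v(second highest)) of these samples (`le_benchmarkGap`). By Myerson's identity, φ of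
the highest sample has conditional mean v(second highest), given the second highest. Hence a second
price auction with 2N = n + (n + 2m - 2) bidders earns E max(φ(highest of A), φ(highest of B)) for
independent halves A and B. Jensen's inequality replaces φ(highest of B) by v(second highest of B),
and positive association then allows B to be replaced by A; both steps can only lower the
expectation (`lintegral_secondHighest_sum_le`).

To stay in [0, ∞], values are truncated at a quantile c and all quantities are measured by their
distance below the greatest truncated value, so that maxima become minima. Fatou's lemma removes the
truncation.

Lower bound. Take the equal-revenue distribution on [1, m] for every item. No price earns more than
1 from one bidder, so VCG earns at most k per item from k bidders. The sum of all values has mean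
m(1 + log m) and concentrates by Chebyshev's inequality, so selling everything to one bidder at half
this mean earns at least m(1 + log m)/4. -/

theorem measurable_update_prod [DecidableEq ι] {X : ι → Type*} [∀ i, MeasurableSpace (X i)]
    (k : ι) : Measurable (fun p : (∀ i, X i) × X k => Function.update p.1 k p.2) := by
  refine measurable_pi_lambda _ fun i => ?_
  by_cases h : i = k
  · subst h; simpa using measurable_snd
  · simp only [Function.update_of_ne h]
    exact (measurable_pi_apply i).comp measurable_fst

variable [Fintype ι] [Fintype κ]

/-- Replacing one coordinate by an independent fresh copy keeps a product law. This is how one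
sample is integrated out with the others fixed. -/
theorem measurePreserving_update [DecidableEq ι] {X : ι → Type*} [∀ i, MeasurableSpace (X i)]
    (μ : ∀ i, Measure (X i)) [∀ i, IsProbabilityMeasure (μ i)] (k : ι) :
    MeasurePreserving (fun p : (∀ i, X i) × X k => Function.update p.1 k p.2)
      ((Measure.pi μ).prod (μ k)) (Measure.pi μ) := by
  have hm := measurable_update_prod (X := X) k
  refine ⟨hm, (Measure.pi_eq fun s hs => ?_).symm⟩
  rw [Measure.map_apply hm (MeasurableSet.univ_pi hs)]
  have : (fun p : (∀ i, X i) × X k => Function.update p.1 k p.2) ⁻¹' (Set.univ.pi s) =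
      (Set.univ.pi (Function.update s k Set.univ)) ×ˢ (s k) := by
    ext p
    simp only [Set.mem_preimage, Set.mem_pi, Set.mem_univ, true_implies, Set.mem_prod]
    constructor
    · intro h
      refine ⟨fun i => ?_, by simpa using h k⟩
      by_cases hi : i = k
      · subst hi; simp
      · simpa [Function.update_of_ne hi] using h i
    · rintro ⟨h, h'⟩ i
      by_cases hi : i = k
      · subst hi; simpa using h'
      · simpa [Function.update_of_ne hi] using h i
  rw [this, Measure.prod_prod, Measure.pi_pi, ← Finset.prod_erase_mul _ _ (Finset.mem_univ k),
    ← Finset.prod_erase_mul Finset.univ (fun i => μ i (s i)) (Finset.mem_univ k)]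
  simp only [Function.update_self, measure_univ, mul_one]
  congr 1
  refine Finset.prod_congr rfl fun i hi => ?_
  rw [Function.update_of_ne (Finset.ne_of_mem_erase hi)]

theorem lintegral_pi_update [DecidableEq ι] {X : ι → Type*} [∀ i, MeasurableSpace (X i)]
    (μ : ∀ i, Measure (X i)) [∀ i, IsProbabilityMeasure (μ i)] (k : ι)
    {G : (∀ i, X i) → ℝ≥0∞} (hG : Measurable G) :
    ∫⁻ C, G C ∂(Measure.pi μ) =
      ∫⁻ C, ∫⁻ x, G (Function.update C k x) ∂(μ k) ∂(Measure.pi μ) := by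
  rw [← (measurePreserving_update μ k).lintegral_comp hG, lintegral_prod]
  exact (hG.comp (measurable_update_prod k)).aemeasurable

theorem lintegral_pi_update_symm [DecidableEq ι] {X : ι → Type*} [∀ i, MeasurableSpace (X i)]
    (μ : ∀ i, Measure (X i)) [∀ i, IsProbabilityMeasure (μ i)] (k : ι)
    {G : (∀ i, X i) → ℝ≥0∞} (hG : Measurable G) :
    ∫⁻ C, G C ∂(Measure.pi μ) =
      ∫⁻ x, ∫⁻ C, G (Function.update C k x) ∂(Measure.pi μ) ∂(μ k) := by
  rw [← (measurePreserving_update μ k).lintegral_comp hG, lintegral_prod_symm]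
  exact (hG.comp (measurable_update_prod k)).aemeasurable

/-- Distinct coordinates of an i.i.d. family are i.i.d. -/
theorem measurePreserving_precomp {X : Type*} [MeasurableSpace X] (ν : Measure X)
    [IsProbabilityMeasure ν] {σ : κ → ι} (hσ : Function.Injective σ) :
    MeasurePreserving (fun C : ι → X => C ∘ σ) (Measure.pi fun _ => ν)
      (Measure.pi fun _ => ν) := by
  have h := ProbabilityTheory.iIndepFun_pi (μ := fun _ : ι => ν) (X := fun _ => (id : X → X))
    (fun _ => aemeasurable_id)
  have h2 := h.precomp hσ
  have h3 := (ProbabilityTheory.iIndepFun_iff_map_fun_eq_pi_map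
    (fun i => (measurable_pi_apply (σ i)).aemeasurable)).1 h2
  refine ⟨by fun_prop, h3.trans ?_⟩
  congr 1
  ext1 i
  exact (measurePreserving_eval (fun _ : ι => ν) (σ i)).map_eq

/-- The entries of an i.i.d. array, in any number of distinct positions, are i.i.d. -/
theorem measurePreserving_precomp_array {ι' : Type*} [Fintype ι'] {X : Type*} [MeasurableSpace X]
    (ν : Measure X) [IsProbabilityMeasure ν] {σ : κ → ι × ι'} (hσ : Function.Injective σ) :
    MeasurePreserving (fun (C : ι → ι' → X) k => C (σ k).1 (σ k).2)
      (Measure.pi fun _ => Measure.pi fun _ => ν) (Measure.pi fun _ => ν) := by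
  have h1 : ProbabilityTheory.iIndepFun (fun (p : ι × ι') (C : ι → ι' → X) => C p.1 p.2)
      (Measure.pi fun _ => Measure.pi fun _ => ν) := by
    have := ProbabilityTheory.iIndepFun_uncurry_infinitePi' (ι := ι) (κ := ι')
      (X := fun _ _ => (id : X → X)) (fun _ _ => ν) (fun _ _ => measurable_id)
    simp only [Measure.infinitePi_eq_pi] at this
    exact this
  have h2 := h1.precomp hσ
  have hm : ∀ k, Measurable (fun C : ι → ι' → X => C (σ k).1 (σ k).2) := fun k => by fun_prop
  have h3 := (ProbabilityTheory.iIndepFun_iff_map_fun_eq_pi_map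
    (fun k => (hm k).aemeasurable)).1 h2
  refine ⟨by fun_prop, h3.trans ?_⟩
  congr 1
  ext1 k
  have e1 := measurePreserving_eval (fun _ : ι => Measure.pi fun _ : ι' => ν) (σ k).1
  have e2 := measurePreserving_eval (fun _ : ι' => ν) (σ k).2
  exact (e2.comp e1).map_eq

end Product

/-! ### The highest and the second highest entry -/

section OrderStatistics

variable {ι κ : Type*} [Fintype ι] [DecidableEq ι] [Fintype κ] [DecidableEq κ]

/-- The highest entry (or `0`, if all entries are negative). -/
def highest (C : ι → ℝ) : ℝ := Finset.univ.fold max 0 C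

/-- The highest entry of the others than `k` (or `0`). -/
def othersHighest (C : ι → ℝ) (k : ι) : ℝ := (Finset.univ.erase k).fold max 0 C

/-- The second highest entry (or `0`). -/
noncomputable def secondHighest (C : ι → ℝ) : ℝ := ⨅ k, othersHighest C k

omit [DecidableEq ι] in
theorem le_highest (C : ι → ℝ) (k : ι) : C k ≤ highest C :=
  Finset.le_fold_max _ |>.2 (Or.inr ⟨k, Finset.mem_univ k, le_rfl⟩)

omit [DecidableEq ι] in
theorem highest_nonneg (C : ι → ℝ) : 0 ≤ highest C :=
  Finset.le_fold_max _ |>.2 (Or.inl le_rfl)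

theorem le_othersHighest (C : ι → ℝ) {k l : ι} (h : l ≠ k) : C l ≤ othersHighest C k :=
  Finset.le_fold_max _ |>.2 (Or.inr ⟨l, by simp [h], le_rfl⟩)

theorem othersHighest_nonneg (C : ι → ℝ) (k : ι) : 0 ≤ othersHighest C k :=
  Finset.le_fold_max _ |>.2 (Or.inl le_rfl)

theorem othersHighest_le_iff {C : ι → ℝ} {k : ι} {c : ℝ} :
    othersHighest C k ≤ c ↔ 0 ≤ c ∧ ∀ l, l ≠ k → C l ≤ c := by
  simp [othersHighest, Finset.fold_max_le]

theorem othersHighest_lt_iff {C : ι → ℝ} {k : ι} {c : ℝ} :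
    othersHighest C k < c ↔ 0 < c ∧ ∀ l, l ≠ k → C l < c := by
  simp [othersHighest, Finset.fold_max_lt]

omit [DecidableEq ι] in
theorem highest_le_iff {C : ι → ℝ} {c : ℝ} : highest C ≤ c ↔ 0 ≤ c ∧ ∀ l, C l ≤ c := by
  simp [highest, Finset.fold_max_le]

theorem othersHighest_le_highest (C : ι → ℝ) (k : ι) : othersHighest C k ≤ highest C :=
  othersHighest_le_iff.2 ⟨highest_nonneg C, fun l _ => le_highest C l⟩

theorem secondHighest_le (C : ι → ℝ) (k : ι) : secondHighest C ≤ othersHighest C k :=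
  ciInf_le (Set.finite_range _).bddBelow k

theorem le_secondHighest [Nonempty ι] {C : ι → ℝ} {c : ℝ} (h : ∀ k, c ≤ othersHighest C k) :
    c ≤ secondHighest C := le_ciInf h

theorem secondHighest_nonneg (C : ι → ℝ) : 0 ≤ secondHighest C :=
  Real.iInf_nonneg (othersHighest_nonneg C)

omit [DecidableEq ι] in
theorem exists_eq_highest [Nonempty ι] {C : ι → ℝ} (h : ∀ k, 0 ≤ C k) :
    ∃ k, C k = highest C := by
  obtain ⟨k, hk⟩ := Finite.exists_max C
  exact ⟨k, le_antisymm (le_highest C k) (highest_le_iff.2 ⟨h k, hk⟩)⟩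

theorem highest_eq_of_lt {C : ι → ℝ} {k : ι} (h : othersHighest C k < C k) :
    highest C = C k := by
  rw [othersHighest_lt_iff] at h
  refine le_antisymm (highest_le_iff.2 ⟨h.1.le, fun l => ?_⟩) (le_highest C k)
  by_cases hl : l = k
  · rw [hl]
  · exact (h.2 l hl).le

theorem secondHighest_eq_of_le {C : ι → ℝ} {k : ι} (h : othersHighest C k ≤ C k) :
    secondHighest C = othersHighest C k := by
  have : Nonempty ι := ⟨k⟩
  refine le_antisymm (secondHighest_le C k) (le_secondHighest fun l => ?_)
  by_cases hl : l = k
  · rw [hl]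
  · exact h.trans (le_othersHighest C (Ne.symm hl))

theorem othersHighest_update (C : ι → ℝ) (k : ι) (x : ℝ) :
    othersHighest (Function.update C k x) k = othersHighest C k := by
  refine le_antisymm ?_ ?_ <;> refine othersHighest_le_iff.2 ⟨othersHighest_nonneg _ _, ?_⟩ <;>
    intro l hl
  · rw [Function.update_of_ne hl]; exact le_othersHighest C hl
  · rw [← Function.update_of_ne hl x C]; exact le_othersHighest _ hl

omit [DecidableEq ι] in
theorem highest_mono : Monotone (highest : (ι → ℝ) → ℝ) := fun _ D h =>
  highest_le_iff.2 ⟨highest_nonneg D, fun l => (h l).trans (le_highest D l)⟩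

theorem othersHighest_mono (k : ι) : Monotone (fun C : ι → ℝ => othersHighest C k) :=
  fun _ D h => othersHighest_le_iff.2
    ⟨othersHighest_nonneg D k, fun l hl => (h l).trans (le_othersHighest D hl)⟩

theorem secondHighest_mono [Nonempty ι] : Monotone (secondHighest : (ι → ℝ) → ℝ) :=
  fun _ _ h => le_secondHighest fun k => (secondHighest_le _ k).trans (othersHighest_mono k h)

/-- Counted with the second highest entry instead of the highest one for her, the entries of the
others sum up to all-but-one times the highest plus the second highest entry. -/
theorem sum_othersHighest [Nonempty ι] {C : ι → ℝ} (h : ∀ k, 0 ≤ C k) :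
    ∑ k, othersHighest C k = (Fintype.card ι - 1) * highest C + secondHighest C := by
  -- Dropping an entry of greatest value leaves the second highest; dropping any other one leaves
  -- the highest.
  obtain ⟨k, hk⟩ := exists_eq_highest h
  have h1 : secondHighest C = othersHighest C k :=
    secondHighest_eq_of_le (hk ▸ othersHighest_le_highest C k)
  rw [← Finset.sum_erase_add _ _ (Finset.mem_univ k), h1]
  congr 1
  rw [Finset.sum_congr rfl (g := fun _ => highest C), Finset.sum_const,
    Finset.card_erase_of_mem (Finset.mem_univ k), nsmul_eq_mul, Finset.card_univ,
    Nat.cast_sub Fintype.card_pos, Nat.cast_one]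
  intro l hl
  exact le_antisymm (othersHighest_le_highest C l)
    (hk ▸ le_othersHighest C (Finset.ne_of_mem_erase hl).symm)

/-- Monotone transformations and the second highest entry. -/
theorem le_secondHighest_comp [Nontrivial ι] {C : ι → ℝ} (hC : ∀ k, 0 ≤ C k) {f : ℝ → ℝ}
    (hf : MonotoneOn f (Set.Ici 0)) : f (secondHighest C) ≤ secondHighest (f ∘ C) := by
  refine le_secondHighest fun k => ?_
  obtain ⟨l, hl⟩ := exists_ne k
  refine (hf (secondHighest_nonneg C) (othersHighest_nonneg C k) (secondHighest_le C k)).trans ?_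
  -- Otherwise all other entries lie strictly below the highest of them. As there is another entry,
  -- the default 0 cannot be that maximum either.
  by_contra! hlt
  have h2 : ∀ l, l ≠ k → C l < othersHighest C k := fun l hl => by
    by_contra! h3
    exact absurd ((hf (othersHighest_nonneg C k) (hC l) h3).trans
      (le_othersHighest (f ∘ C) hl)) (not_le.2 hlt)
  exact lt_irrefl _ (othersHighest_lt_iff.2 ⟨(hC l).trans_lt (h2 l hl), h2⟩)

omit [DecidableEq ι] in
@[fun_prop]
theorem measurable_highest : Measurable (highest : (ι → ℝ) → ℝ) := by
  classical
  have : ∀ s : Finset ι, Measurable (fun C : ι → ℝ => s.fold max 0 C) := by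
    intro s
    induction s using Finset.induction_on with
    | empty => simp
    | insert a s ha ih => simpa [Finset.fold_insert ha] using (measurable_pi_apply a).max ih
  exact this _

@[fun_prop]
theorem measurable_othersHighest (k : ι) : Measurable (fun C : ι → ℝ => othersHighest C k) := by
  have : ∀ s : Finset ι, Measurable (fun C : ι → ℝ => s.fold max 0 C) := by
    intro s
    induction s using Finset.induction_on with
    | empty => simp
    | insert a s ha ih => simpa [Finset.fold_insert ha] using (measurable_pi_apply a).max ih
  exact this _

@[fun_prop]
theorem measurable_secondHighest : Measurable (secondHighest : (ι → ℝ) → ℝ) :=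
  Measurable.iInf measurable_othersHighest

theorem secondHighest_comp_equiv (e : κ ≃ ι) (C : ι → ℝ) :
    secondHighest (C ∘ e) = secondHighest C := by
  have h : ∀ k, othersHighest (C ∘ e) k = othersHighest C (e k) := fun k => by
    refine le_antisymm (othersHighest_le_iff.2 ⟨othersHighest_nonneg _ _, fun l hl =>
      le_othersHighest C (e.injective.ne hl)⟩) (othersHighest_le_iff.2
      ⟨othersHighest_nonneg _ _, fun l hl => ?_⟩)
    have := le_othersHighest (C ∘ e) (l := e.symm l) (k := k)
      (fun h => hl (by rw [← h, Equiv.apply_symm_apply]))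
    simpa using this
  simp only [secondHighest, h]
  exact e.surjective.iInf_comp (g := othersHighest C)

/-! ### Independent samples without ties -/

variable {ν : Measure ℝ} [IsProbabilityMeasure ν] [NullSingletonClass ν]

/-- With one of two coordinates resampled, a tie means hitting a single point, which is a null
event. -/
theorem ae_injective_pi : ∀ᵐ C : ι → ℝ ∂(Measure.pi fun _ => ν), Function.Injective C := by
  have : ∀ k l : ι, k ≠ l → ∀ᵐ C : ι → ℝ ∂(Measure.pi fun _ => ν), C k ≠ C l := by
    intro k l hkl
    have hm : MeasurableSet {C : ι → ℝ | C k = C l} :=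
      measurableSet_eq_fun (by fun_prop) (by fun_prop)
    rw [ae_iff]
    simp only [ne_eq, not_not]
    rw [← lintegral_indicator_one hm, lintegral_pi_update (fun _ => ν) k
      (measurable_one.indicator hm)]
    refine (lintegral_congr fun C => ?_).trans lintegral_zero
    have : (fun x => {C : ι → ℝ | C k = C l}.indicator (1 : (ι → ℝ) → ℝ≥0∞)
        (Function.update C k x)) = Set.indicator {C l} 1 := by
      ext x
      simp [Set.indicator_apply, Function.update_of_ne hkl.symm]
    rw [this, lintegral_indicator_one (measurableSet_singleton _), measure_singleton]
  have h2 := ae_all_iff.2 fun k => ae_all_iff.2 fun l => Filter.eventually_imp_distrib_left.2 (this k l)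
  filter_upwards [h2] with C hC k l hkl
  by_contra hne
  exact hC k l hne hkl

omit [DecidableEq ι] [NullSingletonClass ν] in
theorem ae_pi_of_ae {p : ℝ → Prop} (h : ∀ᵐ x ∂ν, p x) :
    ∀ᵐ C : ι → ℝ ∂(Measure.pi fun _ => ν), ∀ k, p (C k) :=
  ae_all_iff.2 fun k => (measurePreserving_eval (fun _ : ι => ν) k).quasiMeasurePreserving.ae h

theorem ae_exists_othersHighest_lt [Nonempty ι] (hν : ∀ᵐ x ∂ν, 0 < x) :
    ∀ᵐ C : ι → ℝ ∂(Measure.pi fun _ => ν), ∃ k, othersHighest C k < C k := by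
  filter_upwards [ae_injective_pi (ι := ι) (ν := ν), ae_pi_of_ae hν] with C hC hpos
  obtain ⟨k, hk⟩ := Finite.exists_max C
  exact ⟨k, othersHighest_lt_iff.2 ⟨hpos k, fun l hl =>
    lt_of_le_of_ne (hk l) (hC.ne hl)⟩⟩

theorem eq_of_othersHighest_lt {C : ι → ℝ} {k l : ι} (hk : othersHighest C k < C k)
    (hl : othersHighest C l < C l) : k = l := by
  by_contra h
  exact lt_asymm ((le_othersHighest C (Ne.symm h)).trans_lt hk)
    ((le_othersHighest C h).trans_lt hl)

theorem sum_ite_othersHighest_lt {C : ι → ℝ} {k : ι} (hk : othersHighest C k < C k)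
    (g : ι → ℝ≥0∞) :
    ∑ l, (if othersHighest C l < C l then g l else 0) = g k := by
  rw [Finset.sum_eq_single k, if_pos hk]
  · intro l _ hl
    rw [if_neg fun h => hl (eq_of_othersHighest_lt h hk)]
  · simp

/-- Decomposition of an expectation according to the highest of some independent samples. -/
theorem lintegral_highest_secondHighest [Nonempty ι] (hν : ∀ᵐ x ∂ν, 0 < x)
    {H : ℝ → ℝ → ℝ≥0∞} (hH : Measurable (Function.uncurry H)) :
    ∫⁻ C : ι → ℝ, H (highest C) (secondHighest C) ∂(Measure.pi fun _ => ν) =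
      ∑ k, ∫⁻ C : ι → ℝ, ∫⁻ x in Set.Ioi (othersHighest C k), H x (othersHighest C k) ∂ν
        ∂(Measure.pi fun _ => ν) := by
  have hm : ∀ k, MeasurableSet {C : ι → ℝ | othersHighest C k < C k} := fun k =>
    measurableSet_lt (by fun_prop) (by fun_prop)
  have hHk : ∀ k, Measurable (fun C : ι → ℝ => H (C k) (othersHighest C k)) := fun k =>
    hH.comp ((measurable_pi_apply k).prodMk (measurable_othersHighest k))
  calc _ = ∫⁻ C : ι → ℝ, ∑ k, (if othersHighest C k < C k then H (C k) (othersHighest C k)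
        else 0) ∂(Measure.pi fun _ => ν) := by
        refine lintegral_congr_ae ?_
        filter_upwards [ae_exists_othersHighest_lt hν] with C ⟨k, hk⟩
        rw [sum_ite_othersHighest_lt hk, highest_eq_of_lt hk, secondHighest_eq_of_le hk.le]
    _ = _ := by
        rw [lintegral_finsetSum _ fun k _ => Measurable.ite (hm k) (hHk k) measurable_const]
        refine Finset.sum_congr rfl fun k _ => ?_
        -- The highest of the others does not depend on coordinate k, so the event that k wins
        -- becomes the half-line above it for the resampled coordinate.
        rw [lintegral_pi_update (fun _ => ν) k
          (Measurable.ite (hm k) (hHk k) measurable_const)]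
        refine lintegral_congr fun C => ?_
        rw [← lintegral_indicator measurableSet_Ioi]
        refine lintegral_congr fun x => ?_
        simp [Set.indicator_apply, othersHighest_update]

end OrderStatistics

/-! ### The uniform distribution -/

/-- The uniform distribution on the unit interval. -/
noncomputable def uniform : Measure ℝ := volume.restrict (Set.Ioo 0 1)

instance : IsProbabilityMeasure uniform := ⟨by simp [uniform]⟩

instance : NullSingletonClass uniform := by unfold uniform; infer_instance

theorem ae_uniform : ∀ᵐ x ∂uniform, x ∈ Set.Ioo (0 : ℝ) 1 := ae_restrict_mem measurableSet_Ioo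

theorem ae_uniform_pos : ∀ᵐ x ∂uniform, 0 < x := ae_uniform.mono fun _ h => h.1

theorem uniform_restrict_Ioi {s : ℝ} (hs : 0 ≤ s) :
    uniform.restrict (Set.Ioi s) = volume.restrict (Set.Ioo s 1) := by
  rw [uniform, Measure.restrict_restrict measurableSet_Ioi]
  congr 1
  ext x
  simp only [Set.mem_inter_iff, Set.mem_Ioi, Set.mem_Ioo]
  constructor
  · rintro ⟨h, -, h'⟩; exact ⟨h, h'⟩
  · rintro ⟨h, h'⟩; exact ⟨h, hs.trans_lt h, h'⟩

theorem uniform_Ioi {s : ℝ} (hs : 0 ≤ s) : uniform (Set.Ioi s) = ENNReal.ofReal (1 - s) := by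
  rw [← Measure.restrict_apply_univ, uniform_restrict_Ioi hs]
  simp

/-! ### Positive association of antitone functions of independent samples -/

section Association

variable {ι : Type*} [Fintype ι]

/-- Supermodularity of `min`: pairing large with large and small with small gives the greater sum.
-/
theorem min_add_min_le_of_le {a a' b b' : ℝ≥0∞} (ha : a' ≤ a) (hb : b' ≤ b) :
    min a b' + min a' b ≤ min a b + min a' b' := by
  rcases le_total a' b' with h | h
  · rw [min_eq_left h, min_eq_left (h.trans hb)]
    gcongr
  · rw [min_eq_right h, min_eq_right (h.trans ha), add_comm]
    gcongr

/-- Chebyshev's association argument: for two independent points x and y, sum the paired and the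
crossed minima, compare them by supermodularity, and integrate. Both sides come out doubled. -/
theorem lintegral_lintegral_min_le (ν : Measure ℝ) [IsProbabilityMeasure ν] {f g : ℝ → ℝ≥0∞}
    (hf : Antitone f) (hg : Antitone g) :
    ∫⁻ x, ∫⁻ y, min (f x) (g y) ∂ν ∂ν ≤ ∫⁻ x, min (f x) (g x) ∂ν := by
  have hfm := hf.measurable
  have hgm := hg.measurable
  have key : ∀ x y, min (f x) (g y) + min (f y) (g x) ≤ min (f x) (g x) + min (f y) (g y) := by
    intro x y
    rcases le_total x y with h | h
    · exact min_add_min_le_of_le (hf h) (hg h)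
    · rw [add_comm, add_comm (min (f x) (g x))]
      exact min_add_min_le_of_le (hf h) (hg h)
  have h1 : ∫⁻ x, ∫⁻ y, (min (f x) (g y) + min (f y) (g x)) ∂ν ∂ν =
      2 * ∫⁻ x, ∫⁻ y, min (f x) (g y) ∂ν ∂ν := by
    have : ∀ x, ∫⁻ y, (min (f x) (g y) + min (f y) (g x)) ∂ν =
        ∫⁻ y, min (f x) (g y) ∂ν + ∫⁻ y, min (f y) (g x) ∂ν := fun x =>
      lintegral_add_left (by fun_prop) _
    simp_rw [this]
    rw [lintegral_add_left, two_mul]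
    · congr 1
      exact lintegral_lintegral_swap (by fun_prop)
    · exact Measurable.lintegral_prod_right' (f := fun p : ℝ × ℝ => min (f p.1) (g p.2))
        (by fun_prop)
  have h2 : ∫⁻ x, ∫⁻ y, (min (f x) (g x) + min (f y) (g y)) ∂ν ∂ν =
      2 * ∫⁻ x, min (f x) (g x) ∂ν := by
    have : ∀ x, ∫⁻ y, (min (f x) (g x) + min (f y) (g y)) ∂ν =
        min (f x) (g x) + ∫⁻ y, min (f y) (g y) ∂ν := fun x => by
      rw [lintegral_add_left (by fun_prop)]; simp
    simp_rw [this]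
    rw [lintegral_add_left (by fun_prop), two_mul]
    simp
  have h3 := lintegral_mono (μ := ν) fun x => lintegral_mono (μ := ν) (key x)
  rw [h1, h2] at h3
  exact (ENNReal.mul_le_mul_iff_right (by simp) (by simp)).1 h3

/-- The same coordinate is resampled in two independent samples at once, which isolates the
one-dimensional problem in the coupling below. -/
theorem lintegral_prod_pi_update [DecidableEq ι] (ν : Measure ℝ) [IsProbabilityMeasure ν] (k : ι)
    {Φ : (ι → ℝ) × (ι → ℝ) → ℝ≥0∞} (hΦ : Measurable Φ) :
    ∫⁻ p, Φ p ∂((Measure.pi fun _ => ν).prod (Measure.pi fun _ => ν)) =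
      ∫⁻ p, ∫⁻ x, ∫⁻ y, Φ (Function.update p.1 k x, Function.update p.2 k y) ∂ν ∂ν
        ∂((Measure.pi fun _ => ν).prod (Measure.pi fun _ => ν)) := by
  have hu := measurable_update_prod (X := fun _ : ι => ℝ) k
  have hu1 : Measurable fun q : (((ι → ℝ) × (ι → ℝ)) × ℝ) × ℝ =>
      Φ (Function.update q.1.1.1 k q.1.2, Function.update q.1.1.2 k q.2) :=
    hΦ.comp ((hu.comp (f := fun q : (((ι → ℝ) × (ι → ℝ)) × ℝ) × ℝ => (q.1.1.1, q.1.2))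
      (by fun_prop)).prodMk
      (hu.comp (f := fun q : (((ι → ℝ) × (ι → ℝ)) × ℝ) × ℝ => (q.1.1.2, q.2)) (by fun_prop)))
  have hu2 := hu1.lintegral_prod_right' (ν := ν)
  have hu3 := hu2.lintegral_prod_right' (ν := ν)
  rw [lintegral_prod _ hΦ.aemeasurable, lintegral_prod _ hu3.aemeasurable,
    lintegral_pi_update (fun _ => ν) k hΦ.lintegral_prod_right']
  refine lintegral_congr fun A => ?_
  have hu4 := hu2.comp (f := fun q : (ι → ℝ) × ℝ => ((A, q.1), q.2)) (by fun_prop)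
  refine Eq.trans ?_ (lintegral_lintegral_swap (f := fun (B : ι → ℝ) x =>
    ∫⁻ y, Φ (Function.update A k x, Function.update B k y) ∂ν) hu4.aemeasurable).symm
  refine lintegral_congr fun x => ?_
  exact lintegral_pi_update (fun _ => ν) k (hΦ.comp measurable_prodMk_left)

/-- Antitone functions of the same independent samples are positively associated. -/
theorem lintegral_pi_min_le (ν : Measure ℝ) [IsProbabilityMeasure ν] {f g : (ι → ℝ) → ℝ≥0∞}
    (hf : Antitone f) (hg : Antitone g) (hfm : Measurable f) (hgm : Measurable g) :
    ∫⁻ A, ∫⁻ B, min (f A) (g B) ∂(Measure.pi fun _ => ν) ∂(Measure.pi fun _ => ν) ≤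
      ∫⁻ A, min (f A) (g A) ∂(Measure.pi fun _ => ν) := by
  classical
  have hpw : ∀ S : Finset ι, Measurable fun p : (ι → ℝ) × (ι → ℝ) => S.piecewise p.2 p.1 := by
    intro S
    refine measurable_pi_lambda _ fun i => ?_
    by_cases h : i ∈ S
    · simp only [Finset.piecewise_eq_of_mem _ _ _ h]; fun_prop
    · simp only [Finset.piecewise_eq_of_notMem _ _ _ h]; fun_prop
  have hm : ∀ S : Finset ι, Measurable fun p : (ι → ℝ) × (ι → ℝ) =>
      min (f p.1) (g (S.piecewise p.2 p.1)) := fun S =>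
    (hfm.comp measurable_fst).min (hgm.comp (hpw S))
  -- Interpolation: g sees the independent sample on S and the sample of f elsewhere. The empty set
  -- gives one common sample, the full set two independent ones, and each added coordinate is
  -- decoupled by the one-dimensional inequality.
  have key : ∀ S : Finset ι, ∫⁻ p, min (f p.1) (g (S.piecewise p.2 p.1))
      ∂((Measure.pi fun _ => ν).prod (Measure.pi fun _ => ν)) ≤
      ∫⁻ A, min (f A) (g A) ∂(Measure.pi fun _ => ν) := by
    intro S
    induction S using Finset.induction_on with
    | empty =>
      rw [lintegral_prod _ (hm ∅).aemeasurable]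
      simp
    | insert k S hk ih =>
      refine le_trans ?_ ih
      rw [lintegral_prod_pi_update ν k (hm _), lintegral_prod_pi_update ν k (hm _)]
      refine lintegral_mono fun p => ?_
      have h1 : ∀ x y, (insert k S).piecewise (Function.update p.2 k y) (Function.update p.1 k x) =
          Function.update (S.piecewise p.2 p.1) k y := by
        intro x y
        ext i
        by_cases hi : i = k
        · subst hi; simp
        · by_cases hS : i ∈ S <;> simp [Finset.piecewise, hi, hS]
      have h2 : ∀ x y, S.piecewise (Function.update p.2 k y) (Function.update p.1 k x) =
          Function.update (S.piecewise p.2 p.1) k x := by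
        intro x y
        ext i
        by_cases hi : i = k
        · subst hi; simp [Finset.piecewise, hk]
        · by_cases hS : i ∈ S <;> simp [Finset.piecewise, hi, hS]
      simp only [h1, h2, lintegral_const, measure_univ, mul_one]
      refine lintegral_lintegral_min_le ν (fun x y h => hf ?_) (fun x y h => hg ?_) <;>
        exact update_le_update_iff.2 ⟨h, fun _ _ => le_rfl⟩
  have := key Finset.univ
  rw [lintegral_prod _ (hm _).aemeasurable] at this
  simpa using this

end Association

/-! ### An inequality of Bulow-Klemperer type -/

section Doubling

variable {ι : Type*} [Fintype ι] [Nonempty ι] [DecidableEq ι]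

omit [Nonempty ι] in
theorem ae_othersHighest_mem (k : ι) :
    ∀ᵐ C : ι → ℝ ∂(Measure.pi fun _ => uniform), othersHighest C k ∈ Set.Ico (0 : ℝ) 1 := by
  filter_upwards [ae_pi_of_ae (ι := ι) ae_uniform] with C hC
  exact ⟨othersHighest_nonneg C k, othersHighest_lt_iff.2 ⟨one_pos, fun l _ => (hC l).2⟩⟩

/-- If `κ s` is the mean of the antitone function `π` on `(s, 1)`, then `π` of the highest and `κ`
of the second highest sample agree in expectation. -/
theorem lintegral_highest_eq_secondHighest {π κ : ℝ → ℝ≥0∞} (hπ : Antitone π) (hκ : Antitone κ)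
    (h : ∀ s ∈ Set.Ico (0 : ℝ) 1, ∫⁻ x in Set.Ioi s, π x ∂uniform = ENNReal.ofReal (1 - s) * κ s) :
    ∫⁻ C : ι → ℝ, π (highest C) ∂(Measure.pi fun _ => uniform) =
      ∫⁻ C : ι → ℝ, κ (secondHighest C) ∂(Measure.pi fun _ => uniform) := by
  have hπm := hπ.measurable
  have hκm := hκ.measurable
  rw [lintegral_highest_secondHighest ae_uniform_pos (H := fun x _ => π x) (by fun_prop),
    lintegral_highest_secondHighest ae_uniform_pos (H := fun _ s => κ s) (by fun_prop)]
  refine Finset.sum_congr rfl fun k _ => lintegral_congr_ae ?_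
  filter_upwards [ae_othersHighest_mem k] with C hC
  rw [h _ hC, lintegral_const, Measure.restrict_apply_univ, uniform_Ioi hC.1, mul_comm]

/-- Jensen's inequality for the concave function `min c`, conditionally on the second highest sample
s: the highest is then uniform on (s, 1) and its π has mean κ s. -/
theorem lintegral_min_highest_le {π κ : ℝ → ℝ≥0∞} (hπ : Antitone π) (hκ : Antitone κ)
    (h : ∀ s ∈ Set.Ico (0 : ℝ) 1, ∫⁻ x in Set.Ioi s, π x ∂uniform = ENNReal.ofReal (1 - s) * κ s)
    (c : ℝ≥0∞) :
    ∫⁻ C : ι → ℝ, min c (π (highest C)) ∂(Measure.pi fun _ => uniform) ≤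
      ∫⁻ C : ι → ℝ, min c (κ (secondHighest C)) ∂(Measure.pi fun _ => uniform) := by
  have hπm := hπ.measurable
  have hκm := hκ.measurable
  rw [lintegral_highest_secondHighest ae_uniform_pos (H := fun x _ => min c (π x)) (by fun_prop),
    lintegral_highest_secondHighest ae_uniform_pos (H := fun _ s => min c (κ s)) (by fun_prop)]
  refine Finset.sum_le_sum fun k _ => lintegral_mono_ae ?_
  filter_upwards [ae_othersHighest_mem k] with C hC
  rw [lintegral_const, Measure.restrict_apply_univ, uniform_Ioi hC.1]
  rcases le_total c (κ (othersHighest C k)) with hc | hc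
  · rw [min_eq_left hc]
    refine (lintegral_mono fun x => min_le_left _ _).trans ?_
    rw [lintegral_const, Measure.restrict_apply_univ, uniform_Ioi hC.1]
  · rw [min_eq_right hc]
    refine (lintegral_mono fun x => min_le_right _ _).trans ?_
    rw [h _ hC, mul_comm]

omit [DecidableEq ι] [Nonempty ι] in
theorem highest_sum (C : ι ⊕ ι → ℝ) :
    highest C = max (highest (fun i => C (Sum.inl i))) (highest (fun i => C (Sum.inr i))) := by
  refine le_antisymm (highest_le_iff.2 ⟨le_max_of_le_left (highest_nonneg _), ?_⟩)
    (max_le (highest_le_iff.2 ⟨highest_nonneg _, fun i => le_highest C _⟩)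
      (highest_le_iff.2 ⟨highest_nonneg _, fun i => le_highest C _⟩))
  rintro (i | i)
  · exact le_max_of_le_left (le_highest (fun i => C (Sum.inl i)) i)
  · exact le_max_of_le_right (le_highest (fun i => C (Sum.inr i)) i)

/-- Doubling the number of samples, the second highest one beats the better one of the highest and
the second highest of the original samples, counted as `π` and `κ`. (Larger samples have smaller
`π` and `κ`.) -/
theorem lintegral_secondHighest_sum_le {π κ : ℝ → ℝ≥0∞} (hπ : Antitone π) (hκ : Antitone κ)
    (h : ∀ s ∈ Set.Ico (0 : ℝ) 1, ∫⁻ x in Set.Ioi s, π x ∂uniform = ENNReal.ofReal (1 - s) * κ s) :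
    ∫⁻ C : ι ⊕ ι → ℝ, κ (secondHighest C) ∂(Measure.pi fun _ => uniform) ≤
      ∫⁻ A : ι → ℝ, min (π (highest A)) (κ (secondHighest A))
        ∂(Measure.pi fun _ => uniform) := by
  have hπm := hπ.measurable
  have hκm := hκ.measurable
  -- For the doubled sample, κ of the second highest becomes π of the highest, which splits as a
  -- minimum over the two halves.
  rw [← lintegral_highest_eq_secondHighest hπ hκ h]
  refine le_trans ?_ (lintegral_pi_min_le uniform (f := fun A : ι → ℝ => π (highest A))
    (g := fun A => κ (secondHighest A)) (hπ.comp_monotone highest_mono)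
    (hκ.comp_monotone secondHighest_mono) (by fun_prop) (by fun_prop))
  calc _ = ∫⁻ p : (ι → ℝ) × (ι → ℝ), min (π (highest p.1)) (π (highest p.2))
        ∂((Measure.pi fun _ => uniform).prod (Measure.pi fun _ => uniform)) := by
        rw [← (measurePreserving_sumPiEquivProdPi (X := fun _ : ι ⊕ ι => ℝ)
          (fun _ => uniform)).lintegral_comp (by fun_prop)]
        refine lintegral_congr fun C => ?_
        rw [highest_sum, hπ.map_max]
        rfl
    _ = ∫⁻ A : ι → ℝ, ∫⁻ B : ι → ℝ, min (π (highest A)) (π (highest B))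
        ∂(Measure.pi fun _ => uniform) ∂(Measure.pi fun _ => uniform) :=
        lintegral_prod _ (by fun_prop)
    _ ≤ _ := lintegral_mono fun A => lintegral_min_highest_le hπ hκ h _

end Doubling

/-! ### The quantile function -/

section Quantile

variable {μ : Measure ℝ}

/-- The quantile function of a distribution on the real line, extended from `(0, 1)` to the real
line by the least point of the support. -/
noncomputable def quantile (μ : Measure ℝ) (u : ℝ) : ℝ :=
  if u ∈ Set.Ioo (0 : ℝ) 1 then sInf {x | u ≤ μ.real (Set.Iic x)} else sInf μ.support

/-- The Galois connection between quantile function and distribution function; right continuity of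
the latter shows that the infimum is attained. -/
theorem quantile_le_iff [IsProbabilityMeasure μ] {u x : ℝ} (hu : u ∈ Set.Ioo (0 : ℝ) 1) :
    quantile μ u ≤ x ↔ u ≤ μ.real (Set.Iic x) := by
  have hmono : Monotone fun x => μ.real (Set.Iic x) := fun a b h =>
    measureReal_mono (Set.Iic_subset_Iic.2 h)
  have hcdf : (fun x => μ.real (Set.Iic x)) = ProbabilityTheory.cdf μ := by
    ext x; rw [ProbabilityTheory.cdf_eq_real]
  have hne : {x | u ≤ μ.real (Set.Iic x)}.Nonempty := by
    have := (ProbabilityTheory.tendsto_cdf_atTop μ).eventually (lt_mem_nhds hu.2)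
    obtain ⟨y, hy⟩ := this.exists
    exact ⟨y, by rw [← hcdf] at hy; exact hy.le⟩
  have hbdd : BddBelow {x | u ≤ μ.real (Set.Iic x)} := by
    have := (ProbabilityTheory.tendsto_cdf_atBot μ).eventually (gt_mem_nhds hu.1)
    obtain ⟨y, hy⟩ := this.exists
    rw [← hcdf] at hy
    refine ⟨y, fun z hz => ?_⟩
    by_contra! hzy
    exact absurd (hz.trans (hmono hzy.le)) (not_le.2 hy)
  rw [quantile, if_pos hu]
  constructor
  · intro h
    refine le_trans ?_ (hmono h)
    have hr := (ProbabilityTheory.cdf μ).right_continuous (sInf {x | u ≤ μ.real (Set.Iic x)})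
    rw [← hcdf] at hr
    have hr' := hr.tendsto.mono_left (nhdsWithin_mono _ Set.Ioi_subset_Ici_self)
    refine ge_of_tendsto hr' ?_
    filter_upwards [self_mem_nhdsWithin] with y hy
    obtain ⟨z, hz, hzy⟩ := (csInf_lt_iff hbdd hne).1 hy
    exact le_trans hz (hmono hzy.le)
  · intro h
    exact csInf_le hbdd h

theorem lt_quantile_iff [IsProbabilityMeasure μ] {u x : ℝ} (hu : u ∈ Set.Ioo (0 : ℝ) 1) :
    x < quantile μ u ↔ μ.real (Set.Iic x) < u := by
  rw [← not_le, quantile_le_iff hu, not_le]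

theorem quantile_monotoneOn_Ioo [IsProbabilityMeasure μ] :
    MonotoneOn (quantile μ) (Set.Ioo 0 1) := fun _ hu _ hv huv =>
  (quantile_le_iff hu).2 (huv.trans ((quantile_le_iff hv).1 le_rfl))

theorem measurable_quantile [IsProbabilityMeasure μ] : Measurable (quantile μ) := by
  refine measurable_of_Iic fun x => ?_
  have : quantile μ ⁻¹' Set.Iic x = (Set.Ioo 0 1 ∩ Set.Iic (μ.real (Set.Iic x))) ∪
      ((Set.Ioo (0 : ℝ) 1)ᶜ ∩ {_u | sInf μ.support ≤ x}) := by
    ext u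
    by_cases hu : u ∈ Set.Ioo (0 : ℝ) 1
    · simp only [Set.mem_preimage, Set.mem_Iic, quantile_le_iff hu, Set.mem_union, Set.mem_inter_iff,
        hu, true_and, Set.mem_compl_iff, not_true, false_and, or_false]
    · have : quantile μ u = sInf μ.support := if_neg hu
      simp only [Set.mem_preimage, Set.mem_Iic, this, Set.mem_union, Set.mem_inter_iff,
        hu, false_and, Set.mem_compl_iff, not_false_eq_true, true_and, false_or, Set.mem_ofPred_eq]
  rw [this]
  exact (measurableSet_Ioo.inter measurableSet_Iic).union
    (measurableSet_Ioo.compl.inter (MeasurableSet.const _))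

/-- Inverse transform sampling: by the Galois connection, the preimage of a lower half-line has
uniform measure equal to the distribution function. -/
theorem measurePreserving_quantile [IsProbabilityMeasure μ] :
    MeasurePreserving (quantile μ) uniform μ := by
  have : IsProbabilityMeasure (uniform.map (quantile μ)) :=
    Measure.isProbabilityMeasure_map measurable_quantile.aemeasurable
  refine ⟨measurable_quantile, Measure.ext_of_Iic _ _ fun x => ?_⟩
  rw [Measure.map_apply measurable_quantile measurableSet_Iic, uniform,
    Measure.restrict_apply (measurable_quantile measurableSet_Iic)]
  have h1 : quantile μ ⁻¹' Set.Iic x ∩ Set.Ioo 0 1 =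
      Set.Iic (μ.real (Set.Iic x)) ∩ Set.Ioo 0 1 := by
    ext u
    simp only [Set.mem_inter_iff, Set.mem_preimage, Set.mem_Iic]
    exact and_congr_left fun hu => quantile_le_iff hu
  have h2 : (Set.Iic (μ.real (Set.Iic x)) ∩ Set.Ioo 0 1 : Set ℝ) =ᵐ[volume]
      Set.Ioc 0 (μ.real (Set.Iic x)) := by
    have h3 : (Set.Ioo 0 1 : Set ℝ) =ᵐ[volume] Set.Ioc 0 1 := Ioo_ae_eq_Ioc
    have h4 : Set.Iic (μ.real (Set.Iic x)) ∩ Set.Ioc 0 1 = Set.Ioc 0 (μ.real (Set.Iic x)) := by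
      ext u
      simp only [Set.mem_inter_iff, Set.mem_Iic, Set.mem_Ioc]
      have := measureReal_le_one (μ := μ) (s := Set.Iic x)
      exact ⟨fun h => ⟨h.2.1, h.1⟩, fun h => ⟨h.2, h.1, h.2.trans this⟩⟩
    rw [← h4]
    exact ae_eq_set_inter (ae_eq_refl _) h3
  rw [h1, measure_congr h2, Real.volume_Ioc, sub_zero, ofReal_measureReal]

theorem quantile_mem_support_of_mem_Ioo [IsProbabilityMeasure μ] {u : ℝ}
    (hu : u ∈ Set.Ioo (0 : ℝ) 1) : quantile μ u ∈ μ.support := by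
  rw [Measure.mem_support_iff_forall]
  intro U hU
  obtain ⟨a, c, hac, hsub⟩ := mem_nhds_iff_exists_Ioo_subset.1 hU
  obtain ⟨d, hd, hdc⟩ := exists_between hac.2
  refine lt_of_lt_of_le ?_ (measure_mono ((Set.Ioc_subset_Ioo_right hdc).trans hsub))
  have h1 := (lt_quantile_iff hu).1 hac.1
  have h2 := (quantile_le_iff hu).1 hd.le
  rw [pos_iff_ne_zero]
  intro h0
  -- A null neighborhood would make the distribution function constant across the quantile, but it
  -- is below u at a and at least u at d.
  have h3 : μ.real (Set.Iic d) ≤ μ.real (Set.Iic a) := by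
    rw [← Set.Iic_union_Ioc_eq_Iic (hac.1.le.trans hd.le)]
    refine (measureReal_union_le _ _).trans ?_
    simp [measureReal_def, h0]
  linarith

end Quantile

/-! ### Supports and quantiles of nonnegative values -/

section Support

variable {μ : Measure ℝ}

theorem support_nonempty [IsProbabilityMeasure μ] : μ.support.Nonempty :=
  ⟨_, quantile_mem_support_of_mem_Ioo (u := 1 / 2) (by norm_num)⟩

theorem support_subset_Ici (h : μ (Set.Iio 0) = 0) : μ.support ⊆ Set.Ici 0 := by
  intro x hx
  by_contra hlt
  rw [Measure.mem_support_iff_forall] at hx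
  exact (hx _ (Iio_mem_nhds (not_le.1 hlt))).ne' h

theorem csInf_support_mem [IsProbabilityMeasure μ] (h : μ (Set.Iio 0) = 0) :
    sInf μ.support ∈ μ.support :=
  Measure.isClosed_support.csInf_mem support_nonempty ⟨0, fun _ hx => support_subset_Ici h hx⟩

theorem quantile_mem_support [IsProbabilityMeasure μ] (h : μ (Set.Iio 0) = 0) (u : ℝ) :
    quantile μ u ∈ μ.support := by
  by_cases hu : u ∈ Set.Ioo (0 : ℝ) 1
  · exact quantile_mem_support_of_mem_Ioo hu
  · rw [quantile, if_neg hu]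
    exact csInf_support_mem h

theorem quantile_nonneg [IsProbabilityMeasure μ] (h : μ (Set.Iio 0) = 0) (u : ℝ) :
    0 ≤ quantile μ u := support_subset_Ici h (quantile_mem_support h u)

/-- The endpoint 0 matters: the rent of a favorite item starts at quantile 0 when there is no other
item. -/
theorem quantile_monotoneOn [IsProbabilityMeasure μ] (h : μ (Set.Iio 0) = 0) :
    MonotoneOn (quantile μ) (Set.Ico 0 1) := by
  intro u hu v hv huv
  rcases hu.1.eq_or_lt with h0 | h0
  · rw [← h0]
    have : quantile μ 0 = sInf μ.support := if_neg (by simp)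
    rw [this]
    exact csInf_le ⟨0, fun _ hx => support_subset_Ici h hx⟩ (quantile_mem_support h v)
  · exact quantile_monotoneOn_Ioo ⟨h0, hu.2⟩ ⟨h0.trans_le huv, hv.2⟩ huv

end Support

/-! ### Regular distributions in terms of quantiles -/

section Regular

variable {μ : Measure ℝ}

theorem IsRegular.isProbabilityMeasure (h : IsRegular μ) : IsProbabilityMeasure μ := h.1

/-- What the definition of regularity says about the measure, without the monotonicity. -/
structure IsIntervalDensity (μ : Measure ℝ) (I : Set ℝ) (f : ℝ → ℝ) (α : ℝ≥0∞) (b : ℝ) :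
    Prop where
  ordConnected : I.OrdConnected
  subset : I ⊆ Set.Ici 0
  measurable : Measurable f
  pos : ∀ x ∈ I, 0 < f x
  greatest : α ≠ 0 → IsGreatest I b
  eq : μ = (volume.restrict I).withDensity (fun x => ENNReal.ofReal (f x)) + α • Measure.dirac b

namespace IsIntervalDensity

variable {I : Set ℝ} {f : ℝ → ℝ} {α : ℝ≥0∞} {b : ℝ}

theorem measure_compl (h : IsIntervalDensity μ I f α b) : μ Iᶜ = 0 := by
  have hI := h.ordConnected.measurableSet
  rw [h.eq, Measure.add_apply, withDensity_apply _ hI.compl, Measure.restrict_restrict hI.compl]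
  simp only [Set.compl_inter_self, Measure.restrict_empty, lintegral_zero_measure, zero_add,
    Measure.smul_apply, smul_eq_mul, mul_eq_zero]
  by_cases hα : α = 0
  · exact Or.inl hα
  · right
    rw [Measure.dirac_apply' _ hI.compl]
    simp [(h.greatest hα).1]

theorem measure_Iio (h : IsIntervalDensity μ I f α b) : μ (Set.Iio 0) = 0 :=
  measure_mono_null
    (fun _ hx => Set.mem_compl fun hI => not_lt.2 (Set.mem_Ici.1 (h.subset hI))
      (Set.mem_Iio.1 hx)) h.measure_compl

theorem exists_mem (h : IsIntervalDensity μ I f α b) {s : Set ℝ} (hs : μ s ≠ 0) :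
    ∃ x ∈ s, x ∈ I := by
  by_contra! hne
  exact hs (measure_mono_null (fun x hx => hne x hx) h.measure_compl)

theorem measure_Ioo_pos (h : IsIntervalDensity μ I f α b) {a c : ℝ} (hac : a < c)
    (hsub : Set.Ioo a c ⊆ I) : 0 < μ (Set.Ioo a c) := by
  rw [pos_iff_ne_zero]
  intro h0
  rw [h.eq, Measure.add_apply, add_eq_zero, withDensity_apply _ measurableSet_Ioo,
    Measure.restrict_restrict measurableSet_Ioo, Set.inter_eq_left.2 hsub,
    lintegral_eq_zero_iff h.measurable.ennreal_ofReal] at h0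
  have h1 := h0.1
  rw [Filter.EventuallyEq, ae_restrict_iff' measurableSet_Ioo] at h1
  have h2 : ∀ᵐ x ∂(volume : Measure ℝ), x ∉ Set.Ioo a c := by
    filter_upwards [h1] with x hx hxm
    have := hx hxm
    simp only [Pi.zero_apply, ENNReal.ofReal_eq_zero] at this
    exact absurd (h.pos x (hsub hxm)) (not_lt.2 this)
  have h3 : volume (Set.Ioo a c) = 0 := by
    rw [ae_iff] at h2
    simpa only [not_not, Set.ofPred_mem_eq] using h2
  simp only [Real.volume_Ioo, ENNReal.ofReal_eq_zero] at h3
  linarith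

/-- The part with a density charges no point, so a charged point is the atom. -/
theorem isGreatest_of_measure_singleton (h : IsIntervalDensity μ I f α b) {t : ℝ}
    (ht : μ {t} ≠ 0) : IsGreatest I t := by
  rw [h.eq, Measure.add_apply, withDensity_apply _ (measurableSet_singleton t)] at ht
  have h0 : ∫⁻ x in {t}, ENNReal.ofReal (f x) ∂(volume.restrict I) = 0 := by
    rw [Measure.restrict_eq_zero.2]
    · simp
    · exact measure_mono_null Set.Subset.rfl (nonpos_iff_eq_zero.1
        ((Measure.restrict_le_self _).trans_eq Real.volume_singleton))
  rw [h0, zero_add, Measure.smul_apply, smul_eq_mul, Measure.dirac_apply' _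
    (measurableSet_singleton t)] at ht
  have hα : α ≠ 0 := left_ne_zero_of_mul ht
  have hb : b = t := by
    by_contra hne
    exact ht (by simp [hne])
  exact hb ▸ h.greatest hα

theorem Ioo_subset (h : IsIntervalDensity μ I f α b) {a c : ℝ} (ha : a ∈ μ.support)
    (hc : c ∈ μ.support) : Set.Ioo a c ⊆ I := by
  intro t ht
  rw [Measure.mem_support_iff_forall] at ha hc
  obtain ⟨p, hp, hpI⟩ := h.exists_mem (ha _ (Iio_mem_nhds ht.1)).ne'
  obtain ⟨q, hq, hqI⟩ := h.exists_mem (hc _ (Ioi_mem_nhds ht.2)).ne'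
  exact h.ordConnected.out hpI hqI ⟨hp.le, hq.le⟩

/-- Between two points of the support the density is positive, so no open set there is null. The
envelope argument needs whole intervals of admissible reports. -/
theorem support_ordConnected (h : IsIntervalDensity μ I f α b) : μ.support.OrdConnected := by
  refine ⟨fun a ha c hc t ht => ?_⟩
  rcases ht.1.eq_or_lt with rfl | hat
  · exact ha
  rcases ht.2.eq_or_lt with rfl | htc
  · exact hc
  rw [Measure.mem_support_iff_forall]
  intro U hU
  obtain ⟨p, q, hpq, hsub⟩ := mem_nhds_iff_exists_Ioo_subset.1 hU
  refine lt_of_lt_of_le (h.measure_Ioo_pos (a := max a p) (c := min c q) ?_ ?_)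
    (measure_mono (Set.Subset.trans (Set.Ioo_subset_Ioo (le_max_right _ _) (min_le_right _ _))
      hsub))
  · exact (max_lt hat hpq.1).trans (lt_min htc hpq.2)
  · exact (Set.Ioo_subset_Ioo (le_max_left _ _) (min_le_left _ _)).trans (h.Ioo_subset ha hc)

variable [IsProbabilityMeasure μ]

theorem quantile_mem (h : IsIntervalDensity μ I f α b) {u : ℝ} (hu : u ∈ Set.Ioo (0 : ℝ) 1) :
    quantile μ u ∈ I := by
  have h1 : μ (Set.Iic (quantile μ u)) ≠ 0 := by
    intro h0
    have := (quantile_le_iff (μ := μ) hu).1 le_rfl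
    rw [measureReal_def, h0, ENNReal.toReal_zero] at this
    exact absurd hu.1 (not_lt.2 this)
  have h2 : μ (Set.Ici (quantile μ u)) ≠ 0 := by
    rw [← measurePreserving_quantile.measure_preimage measurableSet_Ici.nullMeasurableSet]
    have : Set.Ico u 1 ⊆ quantile μ ⁻¹' Set.Ici (quantile μ u) ∩ Set.Ioo 0 1 := fun s hs =>
      ⟨quantile_monotoneOn_Ioo hu ⟨hu.1.trans_le hs.1, hs.2⟩ hs.1, hu.1.trans_le hs.1, hs.2⟩
    rw [uniform, Measure.restrict_apply (measurable_quantile measurableSet_Ici)]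
    refine (lt_of_lt_of_le ?_ (measure_mono this)).ne'
    simp [hu.2]
  obtain ⟨p, hp, hpI⟩ := h.exists_mem h1
  obtain ⟨q, hq, hqI⟩ := h.exists_mem h2
  exact h.ordConnected.out hpI hqI ⟨hp, hq⟩

/-- A flat piece of the quantile function comes from an atom, and the only possible atom is the
greatest point of the interval. -/
theorem measureReal_Iic_eq_one_of_tie (h : IsIntervalDensity μ I f α b) {s u : ℝ} (hs : 0 < s)
    (hsu : s < u) (hu : u < 1) (htie : quantile μ s = quantile μ u) :
    μ.real (Set.Iic (quantile μ u)) = 1 := by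
  have h1 : μ {quantile μ u} ≠ 0 := by
    rw [← measurePreserving_quantile.measure_preimage
      (measurableSet_singleton _).nullMeasurableSet]
    have : Set.Ioo s u ⊆ quantile μ ⁻¹' {quantile μ u} ∩ Set.Ioo 0 1 := fun r hr => by
      have hr0 : r ∈ Set.Ioo (0 : ℝ) 1 := ⟨hs.trans hr.1, hr.2.trans hu⟩
      refine ⟨le_antisymm (quantile_monotoneOn_Ioo hr0 ⟨hs.trans hsu, hu⟩ hr.2.le) ?_, hr0⟩
      rw [← htie]
      exact quantile_monotoneOn_Ioo ⟨hs, hsu.trans hu⟩ hr0 hr.1.le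
    rw [uniform, Measure.restrict_apply (measurable_quantile (measurableSet_singleton _))]
    refine (lt_of_lt_of_le ?_ (measure_mono this)).ne'
    simp [hsu]
  have h2 := h.isGreatest_of_measure_singleton h1
  have h3 : μ (Set.Iic (quantile μ u))ᶜ = 0 :=
    measure_mono_null
      (fun x hx => Set.mem_compl fun hI => hx (h2.2 hI)) h.measure_compl
  rw [measureReal_def, (prob_compl_eq_zero_iff measurableSet_Iic).1 h3, ENNReal.toReal_one]

/-- Fubini's theorem for the information rent, in terms of quantiles. -/
theorem lintegral_rent (h : IsIntervalDensity μ I f α b) {l c : ℝ} (hl : 0 ≤ l) (hlc : l < c)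
    (hc : c < 1) {x : ℝ → ℝ≥0∞} (hx : Measurable x) :
    (∫⁻ u in Set.Ioo l c, ∫⁻ t in Set.Ioo (quantile μ l) (quantile μ u), x t) +
        ENNReal.ofReal (1 - c) * ∫⁻ t in Set.Ioo (quantile μ l) (quantile μ c), x t =
      ∫⁻ u in Set.Ioo l c, x (quantile μ u) *
        ENNReal.ofReal (quantile μ u - virtualValue μ f (quantile μ u)) := by
  have hμ0 := h.measure_Iio
  have hFmono : Monotone fun x => μ.real (Set.Iic x) := fun a b h =>
    measureReal_mono (Set.Iic_subset_Iic.2 h)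
  have hFm : Measurable fun x => μ.real (Set.Iic x) := hFmono.measurable
  have hlI : l ∈ Set.Ico (0 : ℝ) 1 := ⟨hl, hlc.trans hc⟩
  have hcI : c ∈ Set.Ico (0 : ℝ) 1 := ⟨hl.trans hlc.le, hc⟩
  have hcI' : c ∈ Set.Ioo (0 : ℝ) 1 := ⟨hl.trans_lt hlc, hc⟩
  have hIoo : ∀ u ∈ Set.Ioo l c, u ∈ Set.Ioo (0 : ℝ) 1 := fun u hu =>
    ⟨hl.trans_lt hu.1, hu.2.trans hc⟩
  have hmono := quantile_monotoneOn hμ0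
  set Q := quantile μ with hQ
  set F := fun x => μ.real (Set.Iic x) with hF
  -- Swap the integrals: t lies below the value at quantile u exactly when F t < u. The quantiles
  -- below c contribute c - F t, and the second term adds the missing 1 - c.
  have hleft : (∫⁻ u in Set.Ioo l c, ∫⁻ t in Set.Ioo (Q l) (Q u), x t) +
        ENNReal.ofReal (1 - c) * ∫⁻ t in Set.Ioo (Q l) (Q c), x t =
      ∫⁻ t in Set.Ioo (Q l) (Q c), x t * ENNReal.ofReal (1 - F t) := by
    have h1 : ∀ u ∈ Set.Ioo l c, ∫⁻ t in Set.Ioo (Q l) (Q u), x t =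
        ∫⁻ t in Set.Ioo (Q l) (Q c), x t * (Set.Ioi (F t)).indicator 1 u := by
      intro u hu
      have : Set.Ioo (Q l) (Q u) = {t | F t < u} ∩ Set.Ioo (Q l) (Q c) := by
        ext t
        simp only [Set.mem_Ioo, Set.mem_inter_iff, Set.mem_ofPred_eq]
        rw [hF, ← lt_quantile_iff (hIoo u hu), ← hQ]
        have := hmono ⟨(hIoo u hu).1.le, (hIoo u hu).2⟩ hcI hu.2.le
        constructor
        · rintro ⟨ha, hb⟩; exact ⟨hb, ha, hb.trans_le this⟩
        · rintro ⟨ha, hb, -⟩; exact ⟨hb, ha⟩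
      have hms : MeasurableSet {t | F t < u} := measurableSet_lt hFm measurable_const
      rw [this, ← Measure.restrict_restrict hms, ← lintegral_indicator hms]
      refine lintegral_congr fun t => ?_
      by_cases ht : F t < u <;> simp [ht]
    rw [setLIntegral_congr_fun measurableSet_Ioo h1, lintegral_lintegral_swap,
      ← lintegral_const_mul _ hx, ← lintegral_add_right _ (hx.const_mul _)]
    · refine setLIntegral_congr_fun measurableSet_Ioo fun t ht => ?_
      have hlt : F t < c := (lt_quantile_iff hcI').1 ht.2
      have hge : l ≤ F t := by
        rcases hl.eq_or_lt with h0 | h0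
        · rw [← h0]; exact measureReal_nonneg
        · exact (quantile_le_iff ⟨h0, hlI.2⟩).1 ht.1.le
      rw [lintegral_const_mul _ (measurable_one.indicator measurableSet_Ioi),
        lintegral_indicator_one measurableSet_Ioi, Measure.restrict_apply measurableSet_Ioi]
      have : Set.Ioi (F t) ∩ Set.Ioo l c = Set.Ioo (F t) c := by
        ext u
        simp only [Set.mem_inter_iff, Set.mem_Ioi, Set.mem_Ioo]
        exact ⟨fun hu => ⟨hu.1, hu.2.2⟩, fun hu => ⟨hu.1, hge.trans_lt hu.1, hu.2⟩⟩
      rw [this, Real.volume_Ioo, mul_comm (ENNReal.ofReal (1 - c)), ← mul_add,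
        ← ENNReal.ofReal_add (by linarith) (by linarith)]
      congr 2
      ring
    · refine Measurable.aemeasurable ?_
      refine Measurable.mul (hx.comp measurable_snd) ?_
      have : (fun p : ℝ × ℝ => (Set.Ioi (F p.2)).indicator (1 : ℝ → ℝ≥0∞) p.1) =
          {p : ℝ × ℝ | F p.2 < p.1}.indicator 1 := by
        ext p; simp [Set.indicator_apply]
      rw [this]
      exact measurable_one.indicator (measurableSet_lt (hFm.comp measurable_snd) measurable_fst)
  rw [hleft]
  set K : ℝ → ℝ≥0∞ := fun t => x t * ENNReal.ofReal (t - virtualValue μ f t) with hK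
  have hKm : Measurable K := by
    refine hx.mul (Measurable.ennreal_ofReal ?_)
    unfold virtualValue
    exact measurable_id.sub (measurable_id.sub ((measurable_const.sub hFm).div h.measurable))
  have hsub : Set.Ioo (Q l) (Q c) ⊆ I :=
    h.Ioo_subset (quantile_mem_support hμ0 l) (quantile_mem_support hμ0 c)
  -- Change variables from quantiles to values. The quantile interval and the preimage of the open
  -- value interval can differ only where the quantile function has a tie; there F = 1 and the
  -- integrand vanishes.
  have hright1 : ∫⁻ u in Set.Ioo l c, K (Q u) =
      ∫⁻ u, (Set.Ioo (Q l) (Q c)).indicator K (Q u) ∂uniform := by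
    rw [uniform, ← lintegral_indicator measurableSet_Ioo,
      ← lintegral_indicator (f := fun u => (Set.Ioo (Q l) (Q c)).indicator K (Q u))
        measurableSet_Ioo]
    refine lintegral_congr fun u => ?_
    by_cases hu : u ∈ Set.Ioo l c
    · rw [Set.indicator_of_mem hu, Set.indicator_of_mem (hIoo u hu)]
      have hu0 := hIoo u hu
      have huI : u ∈ Set.Ico (0 : ℝ) 1 := ⟨hu0.1.le, hu0.2⟩
      by_cases hQu : Q u ∈ Set.Ioo (Q l) (Q c)
      · rw [Set.indicator_of_mem hQu]
      · rw [Set.indicator_of_notMem hQu]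
        have h1 : F (Q u) = 1 := by
          by_cases hlu : Q l < Q u
          · have h2 : Q u = Q c := le_antisymm (hmono huI hcI hu.2.le)
              (not_lt.1 fun hlt => hQu ⟨hlu, hlt⟩)
            rw [h2]
            exact h.measureReal_Iic_eq_one_of_tie hu0.1 hu.2 hc h2
          · have hm : l < (l + u) / 2 ∧ (l + u) / 2 < u :=
              ⟨by linarith [hu.1], by linarith [hu.1]⟩
            have hmI : (l + u) / 2 ∈ Set.Ico (0 : ℝ) 1 :=
              ⟨hl.trans hm.1.le, hm.2.trans hu0.2⟩
            refine h.measureReal_Iic_eq_one_of_tie (hl.trans_lt hm.1) hm.2 hu0.2 ?_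
            exact le_antisymm (hmono hmI huI hm.2.le)
              ((not_lt.1 hlu).trans (hmono hlI hmI hm.1.le))
        have h1' : μ.real (Set.Iic (Q u)) = 1 := h1
        simp [hK, virtualValue, h1']
    · rw [Set.indicator_of_notMem hu]
      by_cases hu1 : u ∈ Set.Ioo (0 : ℝ) 1
      · rw [Set.indicator_of_mem hu1, Set.indicator_of_notMem]
        rintro ⟨ha, hb⟩
        have huI : u ∈ Set.Ico (0 : ℝ) 1 := ⟨hu1.1.le, hu1.2⟩
        refine hu ⟨?_, ?_⟩
        · by_contra! hle
          exact absurd (hmono huI hlI hle) (not_le.2 ha)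
        · by_contra! hle
          exact absurd (hmono hcI huI hle) (not_le.2 hb)
      · rw [Set.indicator_of_notMem hu1]
  change _ = ∫⁻ u in Set.Ioo l c, K (Q u)
  rw [hright1, measurePreserving_quantile.lintegral_comp (hKm.indicator measurableSet_Ioo)]
  conv_rhs => rw [h.eq]
  -- The atom is the greatest point, so it does not lie in an open interval that ends at a quantile.
  have hd : α * (Set.Ioo (Q l) (Q c)).indicator K b = 0 := by
    by_cases hα : α = 0
    · rw [hα, zero_mul]
    · rw [Set.indicator_of_notMem, mul_zero]
      exact fun hb => not_lt.2 ((h.greatest hα).2 (h.quantile_mem hcI')) hb.2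
  rw [lintegral_add_measure, lintegral_smul_measure,
    lintegral_dirac' _ (hKm.indicator measurableSet_Ioo), smul_eq_mul, hd, add_zero,
    lintegral_withDensity_eq_lintegral_mul _ h.measurable.ennreal_ofReal
      (hKm.indicator measurableSet_Ioo)]
  have hind : (fun t => ENNReal.ofReal (f t)) * (Set.Ioo (Q l) (Q c)).indicator K =
      (Set.Ioo (Q l) (Q c)).indicator (fun t => ENNReal.ofReal (f t) * K t) := by
    ext t
    by_cases ht : t ∈ Set.Ioo (Q l) (Q c) <;> simp [ht]
  rw [hind, lintegral_indicator measurableSet_Ioo, Measure.restrict_restrict measurableSet_Ioo,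
    Set.inter_eq_left.2 hsub]
  refine setLIntegral_congr_fun measurableSet_Ioo fun t ht => ?_
  have hft := h.pos t (hsub ht)
  simp only [hK]
  rw [mul_left_comm, ← ENNReal.ofReal_mul hft.le]
  congr 2
  simp only [virtualValue, hF]
  field_simp
  ring

end IsIntervalDensity

/-- A regular distribution, in terms of quantiles: `φ u` is the virtual value of the value at
quantile `u`. -/
structure IsQuantileVirtualValue (μ : Measure ℝ) (φ : ℝ → ℝ) : Prop where
  monotoneOn : MonotoneOn φ (Set.Ioo 0 1)
  le : ∀ u ∈ Set.Ioo (0 : ℝ) 1, φ u ≤ quantile μ u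
  rent : ∀ l c : ℝ, 0 ≤ l → l < c → c < 1 → ∀ x : ℝ → ℝ≥0∞, Measurable x →
    (∫⁻ u in Set.Ioo l c, ∫⁻ t in Set.Ioo (quantile μ l) (quantile μ u), x t) +
        ENNReal.ofReal (1 - c) * ∫⁻ t in Set.Ioo (quantile μ l) (quantile μ c), x t =
      ∫⁻ u in Set.Ioo l c, x (quantile μ u) * ENNReal.ofReal (quantile μ u - φ u)

theorem IsRegular.exists_isIntervalDensity (h : IsRegular μ) :
    ∃ I f α b, IsIntervalDensity μ I f α b ∧ MonotoneOn (virtualValue μ f) I := by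
  obtain ⟨-, I, f, α, b, h1, h2, h3, h4, h5, h6, h7⟩ := h
  exact ⟨I, f, α, b, ⟨h1, h2, h3, h4, h5, h6⟩, h7⟩

theorem IsRegular.measure_Iio (h : IsRegular μ) : μ (Set.Iio 0) = 0 := by
  obtain ⟨I, f, α, b, h1, -⟩ := h.exists_isIntervalDensity
  exact h1.measure_Iio

theorem IsRegular.support_ordConnected (h : IsRegular μ) : μ.support.OrdConnected := by
  obtain ⟨I, f, α, b, h1, -⟩ := h.exists_isIntervalDensity
  exact h1.support_ordConnected

/-- Compose the virtual value with the quantile function. For the upper bound these properties,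
nonnegativity of the values and connectedness of the support are all that regularity has to provide.
-/
theorem IsRegular.exists_isQuantileVirtualValue (h : IsRegular μ) :
    ∃ φ, IsQuantileVirtualValue μ φ := by
  have := h.isProbabilityMeasure
  obtain ⟨I, f, α, b, h1, h2⟩ := h.exists_isIntervalDensity
  refine ⟨fun u => virtualValue μ f (quantile μ u), fun u hu v hv huv =>
    h2 (h1.quantile_mem hu) (h1.quantile_mem hv) (quantile_monotoneOn_Ioo hu hv huv),
    fun u hu => ?_, fun l c hl hlc hc x hx => h1.lintegral_rent hl hlc hc hx⟩
  have h3 := h1.pos _ (h1.quantile_mem hu)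
  have h4 := measureReal_le_one (μ := μ) (s := Set.Iic (quantile μ u))
  have : 0 ≤ (1 - μ.real (Set.Iic (quantile μ u))) / f (quantile μ u) :=
    div_nonneg (by linarith) h3.le
  simp only [virtualValue]
  linarith

end Regular

/-! ### Truncated quantile functions and virtual values -/

section Truncation

/-- The quantile function of the distribution truncated at quantile `c`. -/
noncomputable def truncQuantile (μ : Measure ℝ) (c u : ℝ) : ℝ := quantile μ (max 0 (min u c))

/-- The greatest truncated value minus the truncated value. -/
noncomputable def valueGap (μ : Measure ℝ) (c u : ℝ) : ℝ≥0∞ :=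
  ENNReal.ofReal (quantile μ c - truncQuantile μ c u)

/-- The greatest truncated value minus the virtual value of the truncated distribution. -/
noncomputable def virtualGap (μ : Measure ℝ) (φ : ℝ → ℝ) (c u : ℝ) : ℝ≥0∞ :=
  if u ≤ 0 then ∞ else if u < c then ENNReal.ofReal (quantile μ c - φ u) else 0

variable {μ : Measure ℝ} [IsProbabilityMeasure μ] {φ : ℝ → ℝ} {c : ℝ}

theorem truncQuantile_mono (h0 : μ (Set.Iio 0) = 0) (hc : c ∈ Set.Ioo (0 : ℝ) 1) :
    Monotone (truncQuantile μ c) := fun u v huv => by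
  refine quantile_monotoneOn h0 ⟨le_max_left _ _, ?_⟩ ⟨le_max_left _ _, ?_⟩
    (max_le_max le_rfl (min_le_min huv le_rfl)) <;>
  exact max_lt one_pos ((min_le_right _ _).trans_lt hc.2)

omit [IsProbabilityMeasure μ] in
theorem truncQuantile_of_le {u : ℝ} (hu : 0 ≤ u) (huc : u ≤ c) :
    truncQuantile μ c u = quantile μ u := by
  rw [truncQuantile, min_eq_left huc, max_eq_right hu]

omit [IsProbabilityMeasure μ] in
theorem truncQuantile_of_ge {u : ℝ} (hc : 0 ≤ c) (huc : c ≤ u) :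
    truncQuantile μ c u = quantile μ c := by
  rw [truncQuantile, min_eq_right huc, max_eq_right hc]

theorem truncQuantile_le (h0 : μ (Set.Iio 0) = 0) (hc : c ∈ Set.Ioo (0 : ℝ) 1) (u : ℝ) :
    truncQuantile μ c u ≤ quantile μ c := by
  rw [← truncQuantile_of_ge hc.1.le (le_max_right u c)]
  exact truncQuantile_mono h0 hc (le_max_left u c)

theorem truncQuantile_le_quantile (h0 : μ (Set.Iio 0) = 0) (hc : c ∈ Set.Ioo (0 : ℝ) 1) {u : ℝ}
    (hu : u ∈ Set.Ico (0 : ℝ) 1) : truncQuantile μ c u ≤ quantile μ u := by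
  rcases le_total u c with h | h
  · rw [truncQuantile_of_le hu.1 h]
  · rw [truncQuantile_of_ge hc.1.le h]
    exact quantile_monotoneOn h0 ⟨hc.1.le, hc.2⟩ hu h

theorem truncQuantile_nonneg (h0 : μ (Set.Iio 0) = 0) (u : ℝ) : 0 ≤ truncQuantile μ c u :=
  quantile_nonneg h0 _

theorem valueGap_antitone (h0 : μ (Set.Iio 0) = 0) (hc : c ∈ Set.Ioo (0 : ℝ) 1) :
    Antitone (valueGap μ c) := fun _ _ huv =>
  ENNReal.ofReal_le_ofReal (sub_le_sub_left (truncQuantile_mono h0 hc huv) _)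

omit [IsProbabilityMeasure μ] in
-- The value ∞ at quantiles u ≤ 0 makes this hold on the whole line. The value 0 from c on reflects
-- that truncation creates an atom at the top, where virtual value and value agree.
theorem virtualGap_antitone (h : IsQuantileVirtualValue μ φ) (hc : c ∈ Set.Ioo (0 : ℝ) 1) :
    Antitone (virtualGap μ φ c) := by
  intro u v huv
  unfold virtualGap
  by_cases hu : u ≤ 0
  · simp [hu]
  rw [if_neg hu, if_neg (not_le.2 ((not_le.1 hu).trans_le huv))]
  by_cases hv : v < c
  · rw [if_pos hv, if_pos (huv.trans_lt hv)]
    exact ENNReal.ofReal_le_ofReal (sub_le_sub_left (h.monotoneOn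
      ⟨not_le.1 hu, huv.trans_lt (hv.trans hc.2)⟩
      ⟨(not_le.1 hu).trans_le huv, hv.trans hc.2⟩ huv) _)
  · rw [if_neg hv]
    exact zero_le

theorem ofReal_sub_valueGap (h0 : μ (Set.Iio 0) = 0) (hc : c ∈ Set.Ioo (0 : ℝ) 1) (u : ℝ) :
    ENNReal.ofReal (quantile μ c) - valueGap μ c u = ENNReal.ofReal (truncQuantile μ c u) := by
  rw [valueGap, ← ENNReal.ofReal_sub _ (sub_nonneg.2 (truncQuantile_le h0 hc u)), sub_sub_cancel]

theorem valueGap_le (h0 : μ (Set.Iio 0) = 0) (u : ℝ) :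
    valueGap μ c u ≤ ENNReal.ofReal (quantile μ c) :=
  ENNReal.ofReal_le_ofReal (sub_le_self _ (truncQuantile_nonneg h0 u))

omit [IsProbabilityMeasure μ] in
/-- The virtual value never exceeds the value. -/
theorem valueGap_le_virtualGap (h : IsQuantileVirtualValue μ φ) (hc : c ∈ Set.Ioo (0 : ℝ) 1)
    (u : ℝ) : valueGap μ c u ≤ virtualGap μ φ c u := by
  unfold valueGap virtualGap
  split_ifs with h1 h2
  · exact le_top
  · rw [truncQuantile_of_le (not_le.1 h1).le h2.le]
    exact ENNReal.ofReal_le_ofReal (sub_le_sub_left (h.le u ⟨not_le.1 h1, h2.trans hc.2⟩) _)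
  · rw [truncQuantile_of_ge hc.1.le (not_lt.1 h2)]
    simp

/-- Myerson's identity. -/
theorem lintegral_virtualGap (h0 : μ (Set.Iio 0) = 0) (h : IsQuantileVirtualValue μ φ)
    (hc : c ∈ Set.Ioo (0 : ℝ) 1) (s : ℝ) (hs : s ∈ Set.Ico (0 : ℝ) 1) :
    ∫⁻ u in Set.Ioi s, virtualGap μ φ c u ∂uniform = ENNReal.ofReal (1 - s) * valueGap μ c s := by
  rw [uniform_restrict_Ioi hs.1]
  rcases le_or_gt c s with hcs | hsc
  · rw [setLIntegral_congr_fun (g := fun _ => 0) measurableSet_Ioo]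
    · simp [valueGap, truncQuantile_of_ge hc.1.le hcs]
    · intro u hu
      simp only [virtualGap, if_neg (not_le.2 (hs.1.trans_lt hu.1)),
        if_neg (not_lt.2 (hcs.trans hu.1.le))]
  have hcI : c ∈ Set.Ico (0 : ℝ) 1 := ⟨hc.1.le, hc.2⟩
  have hmono := quantile_monotoneOn h0
  have h1 : ∫⁻ u in Set.Ioo s 1, virtualGap μ φ c u =
      ∫⁻ u in Set.Ioo s c, ENNReal.ofReal (quantile μ c - φ u) := by
    have hm := (virtualGap_antitone h hc).measurable
    rw [← Set.Ioo_union_Ico_eq_Ioo hsc hc.2.le, lintegral_union measurableSet_Ico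
      (Set.disjoint_left.2 fun u hu hu' => not_lt.2 hu'.1 hu.2)]
    rw [setLIntegral_congr_fun (g := fun _ => 0) measurableSet_Ico, lintegral_zero, add_zero]
    · refine setLIntegral_congr_fun measurableSet_Ioo fun u hu => ?_
      simp [virtualGap, hs.1.trans_lt hu.1, hu.2]
    · intro u hu
      simp only [virtualGap, if_neg (not_le.2 (hc.1.trans_le hu.1)), if_neg (not_lt.2 hu.1)]
  have hQ : Measurable (quantile μ) := measurable_quantile
  -- Split the virtual gap into the value gap and value minus virtual value. The rent identity with
  -- constant share 1 evaluates the second part.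
  have h2 : ∀ u ∈ Set.Ioo s c, ENNReal.ofReal (quantile μ c - φ u) =
      ENNReal.ofReal (quantile μ c - quantile μ u) + ENNReal.ofReal (quantile μ u - φ u) := by
    intro u hu
    have hu0 : u ∈ Set.Ioo (0 : ℝ) 1 := ⟨hs.1.trans_lt hu.1, hu.2.trans hc.2⟩
    rw [← ENNReal.ofReal_add (sub_nonneg.2 (hmono ⟨hu0.1.le, hu0.2⟩ hcI hu.2.le))
      (sub_nonneg.2 (h.le u hu0))]
    congr 1
    ring
  have h3 := h.rent s c hs.1 hsc hc.2 (fun _ => 1) measurable_const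
  simp only [lintegral_one, Measure.restrict_apply_univ, Real.volume_Ioo, one_mul] at h3
  rw [h1, setLIntegral_congr_fun measurableSet_Ioo h2, lintegral_add_left (by fun_prop), ← h3,
    ← add_assoc, ← lintegral_add_left (by fun_prop), valueGap, truncQuantile_of_le hs.1 hsc.le,
    setLIntegral_congr_fun (g := fun _ => ENNReal.ofReal (quantile μ c - quantile μ s))
      measurableSet_Ioo]
  · rw [lintegral_const, Measure.restrict_apply_univ, Real.volume_Ioo, mul_comm, ← add_mul,
      ← ENNReal.ofReal_add (by linarith) (by linarith [hc.2])]
    congr 2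
    ring
  · intro u hu
    have hu0 : u ∈ Set.Ico (0 : ℝ) 1 := ⟨hs.1.trans hu.1.le, hu.2.trans hc.2⟩
    simp only
    rw [← ENNReal.ofReal_add (sub_nonneg.2 (hmono hu0 hcI hu.2.le))
      (sub_nonneg.2 (hmono hs hu0 hu.1.le))]
    congr 1
    ring

theorem measurable_lintegral_Ioo {β : Type*} [MeasurableSpace β] {a b : β → ℝ}
    (ha : Measurable a) (hb : Measurable b) {x : β → ℝ → ℝ≥0∞}
    (hx : Measurable (Function.uncurry x)) :
    Measurable fun u => ∫⁻ t in Set.Ioo (a u) (b u), x u t := by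
  have hs : MeasurableSet {p : β × ℝ | p.2 ∈ Set.Ioo (a p.1) (b p.1)} :=
    (measurableSet_lt (ha.comp measurable_fst) measurable_snd).inter
      (measurableSet_lt measurable_snd (hb.comp measurable_fst))
  have : (fun u => ∫⁻ t in Set.Ioo (a u) (b u), x u t) =
      fun u => ∫⁻ t, {p : β × ℝ | p.2 ∈ Set.Ioo (a p.1) (b p.1)}.indicator
        (Function.uncurry x) (u, t) := by
    ext u
    rw [← lintegral_indicator measurableSet_Ioo]
    rfl
  rw [this]
  exact (hx.indicator hs).lintegral_prod_right'

/-- Expected payments in a truncated one-dimensional problem are bounded by expected virtual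
values. -/
theorem lintegral_payment_le (h0 : μ (Set.Iio 0) = 0) (hoc : μ.support.OrdConnected)
    (h : IsQuantileVirtualValue μ φ)
    (hc : c ∈ Set.Ioo (0 : ℝ) 1) {l : ℝ} (hl : 0 ≤ l) (hlc : l < c) {x : ℝ → ℝ≥0∞}
    (hx : Measurable x) (hx1 : ∀ t, x t ≤ 1) (hxm : MonotoneOn x μ.support) :
    ∫⁻ u in Set.Ioi l, (ENNReal.ofReal (quantile μ (min u c)) * x (quantile μ (min u c)) -
        ∫⁻ t in Set.Ioo (quantile μ l) (quantile μ (min u c)), x t) ∂uniform ≤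
      ∫⁻ u in Set.Ioi l, (ENNReal.ofReal (quantile μ c) - virtualGap μ φ c u) *
        x (quantile μ u) ∂uniform := by
  rw [uniform_restrict_Ioi hl]
  have hcI : c ∈ Set.Ico (0 : ℝ) 1 := ⟨hc.1.le, hc.2⟩
  have hmono := quantile_monotoneOn h0
  have hsupp := quantile_mem_support (μ := μ) h0
  have hQm : Measurable (quantile μ) := measurable_quantile
  set Q := quantile μ with hQ
  set r : ℝ → ℝ≥0∞ := fun u => ∫⁻ t in Set.Ioo (Q l) (Q u), x t with hr
  have hrm : Measurable r := measurable_lintegral_Ioo measurable_const hQm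
    (hx.comp measurable_snd)
  -- By monotonicity of the share, the rent is at most value times share, so truncated subtraction
  -- loses nothing.
  have hr_le : ∀ u, r u ≤ ENNReal.ofReal (Q u) * x (Q u) := by
    intro u
    calc r u ≤ ∫⁻ t in Set.Ioo (Q l) (Q u), x (Q u) := by
          refine setLIntegral_mono measurable_const fun t ht => ?_
          exact hxm (hoc.out (hsupp l) (hsupp u) ⟨ht.1.le, ht.2.le⟩) (hsupp u) ht.2.le
      _ ≤ _ := by
          rw [lintegral_const, Measure.restrict_apply_univ, Real.volume_Ioo, mul_comm]
          gcongr
          exact sub_le_self _ (quantile_nonneg h0 l)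
  have hdisj : Disjoint (Set.Ioo l c) (Set.Ico c 1) :=
    Set.disjoint_left.2 fun u hu hu' => not_lt.2 hu'.1 hu.2
  have hrent := h.rent l c hl hlc hc.2 x hx
  set J := ∫⁻ u in Set.Ioo l c, x (Q u) * ENNReal.ofReal (Q u - φ u) with hJ
  have hJfin : J ≠ ∞ := by
    rw [← hrent]
    have hrK : ∀ u, u ∈ Set.Ioc l c → r u ≤ ENNReal.ofReal (Q c) := fun u hu => by
      refine (hr_le u).trans ?_
      rw [← mul_one (ENNReal.ofReal (Q c))]
      gcongr
      · exact hmono ⟨hl.trans hu.1.le, hu.2.trans_lt hc.2⟩ hcI hu.2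
      · exact hx1 _
    refine ENNReal.add_ne_top.2 ⟨?_, ENNReal.mul_ne_top ENNReal.ofReal_ne_top
      ((hrK c ⟨hlc, le_rfl⟩).trans_lt ENNReal.ofReal_lt_top).ne⟩
    refine ((setLIntegral_mono measurable_const fun u hu => hrK u ⟨hu.1, hu.2.le⟩).trans_lt ?_).ne
    rw [lintegral_const, Measure.restrict_apply_univ, Real.volume_Ioo]
    exact ENNReal.mul_lt_top ENNReal.ofReal_lt_top ENNReal.ofReal_lt_top
  -- J is the total rent. Being finite, it can be added to both sides; on the left it turns every
  -- payment back into value times share.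
  refine (ENNReal.add_le_add_iff_right hJfin).1 ?_
  have hVm : Measurable (virtualGap μ φ c) := (virtualGap_antitone h hc).measurable
  rw [← Set.Ioo_union_Ico_eq_Ioo hlc hc.2.le, lintegral_union measurableSet_Ico hdisj,
    lintegral_union measurableSet_Ico hdisj]
  have hA : ∫⁻ u in Set.Ioo l c, (ENNReal.ofReal (Q (min u c)) * x (Q (min u c)) -
      ∫⁻ t in Set.Ioo (Q l) (Q (min u c)), x t) =
      ∫⁻ u in Set.Ioo l c, (ENNReal.ofReal (Q u) * x (Q u) - r u) :=
    setLIntegral_congr_fun measurableSet_Ioo fun u hu => by simp only [min_eq_left hu.2.le, hr]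
  have hB : ∫⁻ u in Set.Ico c 1, (ENNReal.ofReal (Q (min u c)) * x (Q (min u c)) -
      ∫⁻ t in Set.Ioo (Q l) (Q (min u c)), x t) =
      ENNReal.ofReal (1 - c) * (ENNReal.ofReal (Q c) * x (Q c) - r c) := by
    rw [setLIntegral_congr_fun (g := fun _ => ENNReal.ofReal (Q c) * x (Q c) - r c)
      measurableSet_Ico fun u hu => by simp only [min_eq_right hu.1, hr]]
    rw [lintegral_const, Measure.restrict_apply_univ, Real.volume_Ico, mul_comm]
  rw [hA, hB]
  calc _ = (∫⁻ u in Set.Ioo l c, ((ENNReal.ofReal (Q u) * x (Q u) - r u) + r u)) +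
        ENNReal.ofReal (1 - c) * ((ENNReal.ofReal (Q c) * x (Q c) - r c) + r c) := by
        rw [← hrent, lintegral_add_right _ hrm, mul_add]
        simp only [hr]
        ring
    _ = (∫⁻ u in Set.Ioo l c, ENNReal.ofReal (Q u) * x (Q u)) +
        ENNReal.ofReal (1 - c) * (ENNReal.ofReal (Q c) * x (Q c)) := by
        simp only [tsub_add_cancel_of_le (hr_le _)]
    _ ≤ (∫⁻ u in Set.Ioo l c, ((ENNReal.ofReal (Q c) - virtualGap μ φ c u) * x (Q u) +
        x (Q u) * ENNReal.ofReal (Q u - φ u))) +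
        ∫⁻ u in Set.Ico c 1, (ENNReal.ofReal (Q c) - virtualGap μ φ c u) * x (Q u) := by
        refine add_le_add (setLIntegral_mono_ae' measurableSet_Ioo
          (Filter.Eventually.of_forall fun u hu => ?_)) ?_
        · have hu0 : 0 < u := hl.trans_lt hu.1
          rw [virtualGap, if_neg (not_le.2 hu0), if_pos hu.2, mul_comm (x (Q u)), ← add_mul]
          gcongr
          have hu1 : u < 1 := hu.2.trans hc.2
          have hle : φ u ≤ Q c := (h.le u ⟨hu0, hu1⟩).trans (hmono ⟨hu0.le, hu1⟩ hcI hu.2.le)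
          -- The truncated difference is the positive part of φ u, which together with Q u - φ u
          -- covers the value Q u.
          rw [← ENNReal.ofReal_sub _ (sub_nonneg.2 hle), sub_sub_cancel]
          refine le_trans (le_of_eq ?_) ENNReal.ofReal_add_le
          rw [add_sub_cancel]
        · have : ENNReal.ofReal (1 - c) * (ENNReal.ofReal (Q c) * x (Q c)) =
              ∫⁻ u in Set.Ico c 1, ENNReal.ofReal (Q c) * x (Q c) := by
            rw [lintegral_const, Measure.restrict_apply_univ, Real.volume_Ico, mul_comm]
          rw [this]
          refine setLIntegral_mono_ae' measurableSet_Ico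
            (Filter.Eventually.of_forall fun u hu => ?_)
          rw [virtualGap, if_neg (not_le.2 (hc.1.trans_le hu.1)), if_neg (not_lt.2 hu.1), tsub_zero]
          gcongr
          -- Above the truncation, the left side uses the share at quantile c, which is at most the
          -- share at u.
          exact hxm (hsupp c) (hsupp u) (hmono hcI ⟨hc.1.le.trans hu.1, hu.2⟩ hu.1)
    _ = _ := by
        have hm : Measurable fun u => (ENNReal.ofReal (Q c) - virtualGap μ φ c u) * x (Q u) :=
          (measurable_const.sub hVm).mul (hx.comp hQm)
        rw [lintegral_add_left hm, add_right_comm]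

end Truncation

/-! ### The revenue of VCG, item by item -/

section VCG

variable {k m : ℕ}

/-- The value that the bidders in `S` get out of an item which goes to `o`. -/
def itemValue (c : Fin k → ℝ) (S : Finset (Fin k)) (o : Option (Fin k)) : ℝ :=
  ∑ i ∈ S, if o = some i then c i else 0

theorem itemValue_le (c : Fin k → ℝ) (S : Finset (Fin k)) (o : Option (Fin k)) :
    itemValue c S o ≤ S.fold max 0 c := by
  rw [itemValue, Finset.le_fold_max]
  rcases o with _ | i
  · simp
  · by_cases hi : i ∈ S
    · exact Or.inr ⟨i, hi, by simp [hi]⟩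
    · exact Or.inl (by simp [hi])

theorem exists_itemValue_eq (c : Fin k → ℝ) (S : Finset (Fin k)) :
    ∃ o, itemValue c S o = S.fold max 0 c := by
  rcases Finset.le_fold_max (S.fold max 0 c) |>.1 (le_refl _) with h | ⟨i, hi, h⟩
  · exact ⟨none, le_antisymm (itemValue_le c S none) (by simpa [itemValue] using h)⟩
  · exact ⟨some i, le_antisymm (itemValue_le c S _) (by simpa [itemValue, hi] using h)⟩

theorem sum_additiveValue (b : Profile k m) (S : Finset (Fin k)) (a : Allocation k m) :
    ∑ i ∈ S, additiveValue (b i) (bundle a i) = ∑ j, itemValue (fun i => b i j) S (a j) := by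
  simp only [additiveValue, bundle, itemValue, Finset.sum_filter]
  exact Finset.sum_comm

/-- The greatest welfare of the bidders in `S`. -/
theorem isGreatest_sum_additiveValue (b : Profile k m) (S : Finset (Fin k)) :
    IsGreatest (Set.range fun a : Allocation k m => ∑ i ∈ S, additiveValue (b i) (bundle a i))
      (∑ j, S.fold max 0 (fun i => b i j)) := by
  choose o ho using fun j => exists_itemValue_eq (fun i => b i j) S
  refine ⟨⟨o, ?_⟩, ?_⟩
  · simp only [sum_additiveValue, ho]
  · rintro _ ⟨a, rfl⟩
    simp only [sum_additiveValue]
    exact Finset.sum_le_sum fun j _ => itemValue_le _ _ _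

theorem welfare_of_isEfficient (b : Profile k m) {a : Allocation k m} (ha : IsEfficient b a) :
    welfare b a = ∑ j, highest (fun i => b i j) := by
  have h := isGreatest_sum_additiveValue b Finset.univ
  obtain ⟨a', ha'⟩ := h.1
  exact le_antisymm (h.2 ⟨a, rfl⟩) (ha'.symm.trans_le (ha a'))

theorem iSup_othersWelfare (b : Profile k m) (i : Fin k) :
    ⨆ a, othersWelfare b i a = ∑ j, othersHighest (fun i => b i j) i :=
  (isGreatest_sum_additiveValue b (Finset.univ.erase i)).csSup_eq

/-- The revenue of VCG is the sum over the items of the second highest bids. -/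
theorem sum_clarkePayment (hk : 0 < k) {b : Profile k m} (hb : ∀ i j, 0 ≤ b i j) :
    ∑ i, clarkePayment b (vcgAllocation b) i = ∑ j, secondHighest (fun i => b i j) := by
  have : Nonempty (Fin k) := ⟨⟨0, hk⟩⟩
  have hw := welfare_of_isEfficient b (exists_isEfficient b).choose_spec
  change welfare b (vcgAllocation b) = _ at hw
  -- The payments sum up to the others' optimal welfares minus k - 1 times the welfare;
  -- `sum_othersHighest` identifies this as the second highest bid, item by item.
  have hs : ∀ j, secondHighest (fun i => b i j) = ∑ i, othersHighest (fun i => b i j) i -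
      (k - 1) * highest (fun i => b i j) := fun j => by
    rw [sum_othersHighest fun i => hb i j, Fintype.card_fin]
    ring
  have ho : ∀ i, othersWelfare b i (vcgAllocation b) =
      welfare b (vcgAllocation b) - additiveValue (b i) (bundle (vcgAllocation b) i) := fun i => by
    have := Finset.add_sum_erase Finset.univ
      (fun i' => additiveValue (b i') (bundle (vcgAllocation b) i')) (Finset.mem_univ i)
    simp only [othersWelfare, welfare]
    linarith
  have hsum : ∑ i, additiveValue (b i) (bundle (vcgAllocation b) i) =
    welfare b (vcgAllocation b) := rfl
  simp only [clarkePayment, iSup_othersWelfare, ho, hs, Finset.sum_sub_distrib, hsum, hw]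
  rw [Finset.sum_comm, Finset.sum_const, Finset.card_univ, Fintype.card_fin, nsmul_eq_mul,
    ← Finset.mul_sum]
  ring

variable {F : Fin m → Measure ℝ}

theorem ae_profileDist_nonneg [∀ j, IsProbabilityMeasure (F j)] (hF : ∀ j, F j (Set.Iio 0) = 0) :
    ∀ᵐ b ∂(profileDist F k), ∀ i j, 0 ≤ b i j := by
  have h1 : ∀ j, ∀ᵐ x ∂(F j), 0 ≤ x := fun j => by
    have : {x : ℝ | ¬ 0 ≤ x} = Set.Iio 0 := by ext; simp
    rw [ae_iff, this, hF j]
  have h2 : ∀ᵐ v ∂(typeDist F), ∀ j, 0 ≤ v j := ae_all_iff.2 fun j =>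
    (measurePreserving_eval F j).quasiMeasurePreserving.ae (h1 j)
  have : IsProbabilityMeasure (typeDist F) := by unfold typeDist; infer_instance
  exact ae_all_iff.2 fun i =>
    (measurePreserving_eval (fun _ : Fin k => typeDist F) i).quasiMeasurePreserving.ae h2

/-- The bids for one item are independent and identically distributed. -/
theorem measurePreserving_column [∀ j, IsProbabilityMeasure (F j)] (j : Fin m) :
    MeasurePreserving (fun (b : Profile k m) i => b i j) (profileDist F k)
      (Measure.pi fun _ => F j) := by
  have : IsProbabilityMeasure (typeDist F) := by unfold typeDist; infer_instance
  exact measurePreserving_pi (fun _ : Fin k => typeDist F) (fun _ => F j)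
    fun _ => measurePreserving_eval F j

theorem vcgRevenue_eq [∀ j, IsProbabilityMeasure (F j)] (hF : ∀ j, F j (Set.Iio 0) = 0)
    (hk : 0 < k) :
    vcgRevenue F k =
      ∑ j, ∫⁻ C : Fin k → ℝ, ENNReal.ofReal (secondHighest C) ∂(Measure.pi fun _ => F j) := by
  have h1 : vcgRevenue F k =
      ∫⁻ b : Profile k m, ∑ j, ENNReal.ofReal (secondHighest fun i => b i j) ∂(profileDist F k) := by
    refine lintegral_congr_ae ?_
    filter_upwards [ae_profileDist_nonneg hF] with b hb
    rw [sum_clarkePayment hk hb, ENNReal.ofReal_sum_of_nonneg fun j _ => secondHighest_nonneg _]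
  have hm : ∀ j, Measurable fun b : Profile k m => ENNReal.ofReal (secondHighest fun i => b i j) :=
    fun j => (measurable_secondHighest.comp (measurePreserving_column (F := F) j).1).ennreal_ofReal
  rw [h1, lintegral_finsetSum _ fun j _ => hm j]
  refine Finset.sum_congr rfl fun j _ => ?_
  exact (measurePreserving_column j).lintegral_comp (measurable_secondHighest.ennreal_ofReal)

/-- In terms of quantiles. -/
theorem lintegral_truncQuantile_le {ι : Type*} [Fintype ι] [DecidableEq ι] [Nontrivial ι]
    {μ : Measure ℝ} [IsProbabilityMeasure μ] (h0 : μ (Set.Iio 0) = 0) {c : ℝ}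
    (hc : c ∈ Set.Ioo (0 : ℝ) 1) :
    ∫⁻ C : ι → ℝ, ENNReal.ofReal (truncQuantile μ c (secondHighest C))
        ∂(Measure.pi fun _ => uniform) ≤
      ∫⁻ C : ι → ℝ, ENNReal.ofReal (secondHighest C) ∂(Measure.pi fun _ => μ) := by
  have h1 := measurePreserving_pi (fun _ : ι => uniform) (fun _ => μ)
    fun _ => measurePreserving_quantile (μ := μ)
  rw [← h1.lintegral_comp measurable_secondHighest.ennreal_ofReal]
  refine lintegral_mono_ae ?_
  filter_upwards [ae_pi_of_ae (ι := ι) ae_uniform] with C hC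
  refine ENNReal.ofReal_le_ofReal ?_
  -- Only an inequality is needed: truncating each value can only lower the second highest.
  refine (le_secondHighest_comp (fun i => (hC i).1.le)
    ((truncQuantile_mono h0 hc).monotoneOn _)).trans (secondHighest_mono fun i => ?_)
  exact truncQuantile_le_quantile h0 hc ⟨(hC i).1.le, (hC i).2⟩

end VCG

/-! ### The benchmark of one item -/

section Benchmark

variable {n m : ℕ} {μ : Measure ℝ} {φ : ℝ → ℝ} {c : ℝ}

/-- The contribution of an item `j` to the benchmark, for a bidder whose values have quantiles `v`:
the virtual value if `j` is her favorite item, the value otherwise; as the distance to the greatest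
truncated value. -/
noncomputable def benchmarkGap (μ : Measure ℝ) (φ : ℝ → ℝ) (c : ℝ) (j : Fin m) (v : Fin m → ℝ) :
    ℝ≥0∞ :=
  if othersHighest v j < v j then virtualGap μ φ c (v j) else valueGap μ c (v j)

/-- The quantiles of all bidders for item `j` and of bidder `i` for the other items. -/
def sampleIndex (j : Fin m) (i : Fin n) : Fin n ⊕ {k : Fin m // k ≠ j} → Fin n × Fin m
  | Sum.inl i' => (i', j)
  | Sum.inr k => (i, k)

theorem sampleIndex_injective (j : Fin m) (i : Fin n) :
    Function.Injective (sampleIndex j i) := by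
  rintro (i' | k) (i'' | k') h
  · simp only [sampleIndex, Prod.mk.injEq, and_true] at h
    rw [h]
  · simp only [sampleIndex, Prod.mk.injEq] at h
    exact absurd h.2.symm k'.2
  · simp only [sampleIndex, Prod.mk.injEq] at h
    exact absurd h.2 k.2
  · simp only [sampleIndex, Prod.mk.injEq, true_and] at h
    rw [Subtype.ext h]

variable [IsProbabilityMeasure μ]

/-- Bidder i has the highest quantile for item j. If j is also her favorite, her quantile is the
highest of all samples. Otherwise another entry of her row is at least as high, so her quantile for
j is at most the second highest sample. The other bidders are below i for j, so their quantiles are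
also at most the second highest, and virtual values do not exceed values. -/
theorem le_benchmarkGap (h0 : μ (Set.Iio 0) = 0) (h : IsQuantileVirtualValue μ φ)
    (hc : c ∈ Set.Ioo (0 : ℝ) 1) {j : Fin m} {u : Fin n → Fin m → ℝ} {i : Fin n}
    (hi : othersHighest (fun i' => u i' j) i < u i j) (i' : Fin n) :
    min (virtualGap μ φ c (highest fun k => u (sampleIndex j i k).1 (sampleIndex j i k).2))
        (valueGap μ c (secondHighest fun k => u (sampleIndex j i k).1 (sampleIndex j i k).2)) ≤
      benchmarkGap μ φ c j (u i') := by
  have : Nonempty (Fin n) := ⟨i⟩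
  set A : Fin n ⊕ {k : Fin m // k ≠ j} → ℝ :=
    fun k => u (sampleIndex j i k).1 (sampleIndex j i k).2 with hA
  have hAl : ∀ l, A (Sum.inl l) = u l j := fun _ => rfl
  have hAr : ∀ k, A (Sum.inr k) = u i k := fun _ => rfl
  rw [othersHighest_lt_iff] at hi
  by_cases hii : i' = i
  · subst hii
    unfold benchmarkGap
    split_ifs with hl
    · refine (min_le_left _ _).trans (le_of_eq ?_)
      have : highest A = A (Sum.inl i') := by
        refine highest_eq_of_lt (othersHighest_lt_iff.2 ⟨hi.1, ?_⟩)
        rw [othersHighest_lt_iff] at hl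
        rintro (l | k) hk
        · exact hi.2 l fun h => hk (by rw [h])
        · exact hl.2 k k.2
      rw [this, hAl]
    · refine (min_le_right _ _).trans (valueGap_antitone h0 hc (le_secondHighest fun k => ?_))
      by_cases hk : k = Sum.inl i'
      · subst hk
        exact (not_lt.1 hl).trans (othersHighest_le_iff.2 ⟨othersHighest_nonneg _ _, fun l hl =>
          le_othersHighest A (l := Sum.inr ⟨l, hl⟩) (by simp)⟩)
      · exact le_othersHighest A (Ne.symm hk)
  · refine (min_le_right _ _).trans ((valueGap_antitone h0 hc
      (le_secondHighest fun k => ?_ : u i' j ≤ secondHighest A)).trans ?_)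
    · by_cases hk : k = Sum.inl i'
      · subst hk
        exact (hi.2 i' hii).le.trans (le_othersHighest A (l := Sum.inl i) (by simpa using Ne.symm hii))
      · exact le_othersHighest A (Ne.symm hk)
    · unfold benchmarkGap
      split_ifs
      · exact valueGap_le_virtualGap h hc _
      · exact le_rfl

theorem measurable_benchmarkGap (h0 : μ (Set.Iio 0) = 0) (h : IsQuantileVirtualValue μ φ)
    (hc : c ∈ Set.Ioo (0 : ℝ) 1) (j : Fin m) : Measurable (benchmarkGap μ φ c j) :=
  Measurable.ite (measurableSet_lt (by fun_prop) (by fun_prop))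
    ((virtualGap_antitone h hc).measurable.comp (measurable_pi_apply j))
    ((valueGap_antitone h0 hc).measurable.comp (measurable_pi_apply j))

/-- The benchmark of one item is at most the revenue of the second price auction with
`n + 2m - 2` additional bidders. -/
theorem lintegral_iSup_benchmark_le (hn : 1 ≤ n) (h0 : μ (Set.Iio 0) = 0)
    (h : IsQuantileVirtualValue μ φ) (hc : c ∈ Set.Ioo (0 : ℝ) 1) (j : Fin m) :
    ∫⁻ u : Fin n → Fin m → ℝ,
        ⨆ i, (ENNReal.ofReal (quantile μ c) - benchmarkGap μ φ c j (u i))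
        ∂(Measure.pi fun _ => Measure.pi fun _ => uniform) ≤
      ∫⁻ C : Fin (n + (n + 2 * m - 2)) → ℝ, ENNReal.ofReal (truncQuantile μ c (secondHighest C))
        ∂(Measure.pi fun _ => uniform) := by
  have hne : Nonempty (Fin n) := ⟨⟨0, hn⟩⟩
  set K := ENNReal.ofReal (quantile μ c) with hK
  have hπ := virtualGap_antitone h hc
  have hκ := valueGap_antitone h0 hc
  have hπm := hπ.measurable
  have hκm := hκ.measurable
  set G : (Fin n ⊕ {k : Fin m // k ≠ j} → ℝ) → ℝ≥0∞ := fun A =>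
    K - min (virtualGap μ φ c (highest A)) (valueGap μ c (secondHighest A)) with hG
  have hGm : Measurable G := by fun_prop
  have hmp : ∀ i, MeasurePreserving (fun (u : Fin n → Fin m → ℝ) k =>
      u (sampleIndex j i k).1 (sampleIndex j i k).2)
      (Measure.pi fun _ => Measure.pi fun _ => uniform) (Measure.pi fun _ => uniform) := fun i =>
    measurePreserving_precomp_array uniform (sampleIndex_injective j i)
  -- The samples depend on the random winner i. The event that i wins involves only the column of
  -- item j, so all cases can be moved to one common sample space, where these events are disjoint.
  set G' : Fin n → (Fin n ⊕ {k : Fin m // k ≠ j} → ℝ) → ℝ≥0∞ := fun i A =>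
    if othersHighest (fun i' => A (Sum.inl i')) i < A (Sum.inl i) then G A else 0 with hG'
  have hG'm : ∀ i, Measurable (G' i) := fun i =>
    Measurable.ite (measurableSet_lt ((measurable_othersHighest i).comp (by fun_prop))
      (by fun_prop)) hGm measurable_const
  have hcol : ∀ᵐ u : Fin n → Fin m → ℝ ∂(Measure.pi fun _ => Measure.pi fun _ => uniform),
      ∃ i, othersHighest (fun i' => u i' j) i < u i j := by
    have h1 := measurePreserving_precomp_array (ι := Fin n) (ι' := Fin m) (κ := Fin n) uniform
      (σ := fun i => (i, j)) (fun a b hab => (Prod.mk.inj hab).1)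
    exact h1.quasiMeasurePreserving.ae (ae_exists_othersHighest_lt ae_uniform_pos)
  -- Each half consists of n + m - 1 samples, and 2(n + m - 1) = n + (n + 2m - 2).
  have hcard : Fintype.card (Fin (n + (n + 2 * m - 2))) =
      Fintype.card ((Fin n ⊕ {k : Fin m // k ≠ j}) ⊕ (Fin n ⊕ {k : Fin m // k ≠ j})) := by
    have hm : 1 ≤ m := Fin.pos j
    simp only [Fintype.card_fin, Fintype.card_sum, ne_eq, Fintype.card_subtype_compl,
      Fintype.card_subtype_eq]
    omega
  obtain ⟨e⟩ := Fintype.card_eq.1 hcard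
  calc _ ≤ ∫⁻ u : Fin n → Fin m → ℝ, ∑ i,
        G' i (fun k => u (sampleIndex j i k).1 (sampleIndex j i k).2)
        ∂(Measure.pi fun _ => Measure.pi fun _ => uniform) := by
        refine lintegral_mono_ae ?_
        filter_upwards [hcol] with u ⟨i, hi⟩
        refine le_trans ?_ (Finset.single_le_sum (fun _ _ => zero_le) (Finset.mem_univ i))
        have : G' i (fun k => u (sampleIndex j i k).1 (sampleIndex j i k).2) =
          G (fun k => u (sampleIndex j i k).1 (sampleIndex j i k).2) := if_pos hi
        rw [this]
        exact iSup_le fun i' => tsub_le_tsub_left (le_benchmarkGap h0 h hc hi i') _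
    _ = ∑ i, ∫⁻ A, G' i A ∂(Measure.pi fun _ => uniform) := by
        refine (lintegral_finsetSum _ fun i _ => (hG'm i).comp (hmp i).1).trans ?_
        exact Finset.sum_congr rfl fun i _ => (hmp i).lintegral_comp (hG'm i)
    _ = ∫⁻ A, ∑ i, G' i A ∂(Measure.pi fun _ => uniform) :=
        (lintegral_finsetSum _ fun i _ => hG'm i).symm
    _ ≤ ∫⁻ A, G A ∂(Measure.pi fun _ => uniform) := by
        refine lintegral_mono fun A => ?_
        by_cases hA : ∃ i, othersHighest (fun i' => A (Sum.inl i')) i < A (Sum.inl i)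
        · obtain ⟨i, hi⟩ := hA
          exact (sum_ite_othersHighest_lt (C := fun i' => A (Sum.inl i')) hi
            (fun _ => G A)).le
        · push Not at hA
          rw [Finset.sum_eq_zero fun i _ => if_neg (not_lt.2 (hA i))]
          exact zero_le
    _ = K - ∫⁻ A : Fin n ⊕ {k : Fin m // k ≠ j} → ℝ,
          min (virtualGap μ φ c (highest A)) (valueGap μ c (secondHighest A))
          ∂(Measure.pi fun _ => uniform) := by
        have hle : ∀ A : Fin n ⊕ {k : Fin m // k ≠ j} → ℝ,
            min (virtualGap μ φ c (highest A)) (valueGap μ c (secondHighest A)) ≤ K :=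
          fun A => (min_le_right _ _).trans (valueGap_le h0 _)
        rw [lintegral_sub (by fun_prop) _ (Filter.Eventually.of_forall hle), lintegral_const,
          measure_univ, mul_one]
        refine ((lintegral_mono hle).trans_lt ?_).ne
        rw [lintegral_const, measure_univ, mul_one]
        exact ENNReal.ofReal_lt_top
    _ ≤ K - ∫⁻ C : (Fin n ⊕ {k : Fin m // k ≠ j}) ⊕ (Fin n ⊕ {k : Fin m // k ≠ j}) → ℝ,
          valueGap μ c (secondHighest C) ∂(Measure.pi fun _ => uniform) :=
        tsub_le_tsub_left (lintegral_secondHighest_sum_le hπ hκ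
          (lintegral_virtualGap h0 h hc)) _
    _ ≤ ∫⁻ C : (Fin n ⊕ {k : Fin m // k ≠ j}) ⊕ (Fin n ⊕ {k : Fin m // k ≠ j}) → ℝ,
          (K - valueGap μ c (secondHighest C)) ∂(Measure.pi fun _ => uniform) := by
        refine le_trans (le_of_eq ?_) (lintegral_sub_le _ _ (by fun_prop))
        rw [lintegral_const, measure_univ, mul_one]
    _ = _ := by
        simp only [hK, ofReal_sub_valueGap h0 hc]
        have hm : Measurable (truncQuantile μ c) := (truncQuantile_mono h0 hc).measurable
        rw [← (measurePreserving_precomp uniform e.symm.injective).lintegral_comp (by fun_prop)]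
        refine lintegral_congr fun C => ?_
        rw [secondHighest_comp_equiv]

end Benchmark

/-! ### The envelope inequality -/

section Envelope

/-- A function is at least the integral of its subgradients. -/
theorem integral_le_sub_of_subgradient {W x : ℝ → ℝ} {a c : ℝ} (hac : a ≤ c)
    (hW : ∀ s ∈ Set.Icc a c, ∀ t ∈ Set.Icc a c, W s + (t - s) * x s ≤ W t) :
    ∫ t in a..c, x t ≤ W c - W a := by
  -- Add the two subgradient inequalities between s and t.
  have hmono : MonotoneOn x (Set.Icc a c) := by
    intro s hs t ht hst
    rcases hst.eq_or_lt with rfl | hst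
    · exact le_rfl
    have h1 := hW s hs t ht
    have h2 := hW t ht s hs
    nlinarith
  -- For N + 1 equal steps, the left Riemann sum of x is at most the telescoping sum of the
  -- increments of W. The right sum, which bounds the integral, exceeds it by one step times x c - x
  -- a.
  have key : ∀ N : ℕ, ∫ t in a..c, x t ≤ W c - W a + (c - a) / (N + 1 : ℝ) * (x c - x a) := by
    intro N
    set h := (c - a) / (N + 1 : ℝ) with hh
    have hN : (0 : ℝ) < N + 1 := by positivity
    have hh0 : 0 ≤ h := div_nonneg (sub_nonneg.2 hac) hN.le
    have hhN : h * (N + 1) = c - a := div_mul_cancel₀ _ hN.ne'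
    have hmem : ∀ y ∈ Set.Icc (0 : ℝ) (N + 1), a + h * y ∈ Set.Icc a c := by
      intro y hy
      have := mul_le_mul_of_nonneg_left hy.2 hh0
      exact ⟨by nlinarith [hy.1], by linarith⟩
    have hg : MonotoneOn (fun y => x (a + h * y)) (Set.Icc (0 : ℝ) (0 + (N + 1 : ℕ))) := by
      intro y hy z hz hyz
      simp only [zero_add, Nat.cast_add, Nat.cast_one] at hy hz
      exact hmono (hmem y hy) (hmem z hz)
        (add_le_add_right (mul_le_mul_of_nonneg_left hyz hh0) a)
    have h1 := hg.integral_le_sum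
    have h2 := intervalIntegral.smul_integral_comp_add_mul (a := 0) (b := (N + 1 : ℝ)) x h a
    rw [mul_zero, add_zero, hhN, add_sub_cancel, smul_eq_mul] at h2
    rw [← h2]
    simp only [zero_add, Nat.cast_add, Nat.cast_one] at h1
    refine (mul_le_mul_of_nonneg_left h1 hh0).trans ?_
    have h3 : ∀ i ∈ Finset.range (N + 1),
        h * x (a + h * i) ≤ W (a + h * ((i + 1 : ℕ) : ℝ)) - W (a + h * i) := by
      intro i hi
      have hi' : (i : ℝ) + 1 ≤ N + 1 := by exact_mod_cast Finset.mem_range.1 hi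
      have h4 := hW _ (hmem i ⟨by positivity, by linarith⟩) _ (hmem (i + 1) ⟨by positivity, hi'⟩)
      push_cast
      have : a + h * (i + 1) - (a + h * i) = h := by ring
      rw [this] at h4
      linarith
    have h5 := Finset.sum_le_sum h3
    rw [Finset.sum_range_sub (fun i : ℕ => W (a + h * i)), ← Finset.mul_sum] at h5
    have h6 := Finset.sum_range_sub (fun i : ℕ => x (a + h * i)) (N + 1)
    rw [Finset.sum_sub_distrib] at h6
    push_cast at h5 h6
    rw [hhN, mul_zero, add_zero, add_sub_cancel] at h5 h6
    have h7 := congrArg (fun z => h * z) h6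
    simp only [mul_sub] at h7 ⊢
    linarith
  have hlim : Filter.Tendsto (fun N : ℕ => W c - W a + (c - a) / (N + 1 : ℝ) * (x c - x a))
      Filter.atTop (nhds (W c - W a + 0 * (x c - x a))) := by
    refine tendsto_const_nhds.add (Filter.Tendsto.mul_const _ ?_)
    have := (tendsto_one_div_add_atTop_nhds_zero_nat (𝕜 := ℝ)).const_mul (c - a)
    simpa [div_eq_mul_inv] using this
  have := ge_of_tendsto' hlim key
  simpa using this

end Envelope

/-! ### Interim allocations and payments -/

namespace Mechanism

variable {n m : ℕ} (M : Mechanism n m) (F : Fin m → Measure ℝ)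

/-- The probability that bidder `i` gets item `j`. -/
noncomputable def allocProb (b : Profile n m) (i : Fin n) (j : Fin m) : ℝ :=
  ∑ a : Allocation n m, if a j = some i then M.lottery b a else 0

/-- The interim probability that bidder `i` gets item `j` if she reports `r`. -/
noncomputable def share (i : Fin n) (j : Fin m) (r : BidderType m) : ℝ≥0∞ :=
  ∫⁻ w, ENNReal.ofReal (M.allocProb (Function.update w i r) i j) ∂(profileDist F n)

/-- The interim payment of bidder `i` if she reports `r`. -/
noncomputable def interimPayment (i : Fin n) (r : BidderType m) : ℝ :=
  ∫ w, M.payment (Function.update w i r) i ∂(profileDist F n)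

theorem lottery_nonneg (b : Profile n m) (a : Allocation n m) : 0 ≤ M.lottery b a :=
  (M.lottery_mem b).1 a

theorem allocProb_nonneg (b : Profile n m) (i : Fin n) (j : Fin m) : 0 ≤ M.allocProb b i j :=
  Finset.sum_nonneg fun a _ => by
    split_ifs
    · exact M.lottery_nonneg b a
    · exact le_rfl

theorem sum_allocProb_le (b : Profile n m) (j : Fin m) : ∑ i, M.allocProb b i j ≤ 1 := by
  unfold allocProb
  rw [Finset.sum_comm, ← (M.lottery_mem b).2]
  refine Finset.sum_le_sum fun a _ => ?_
  rcases a j with _ | i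
  · simpa using M.lottery_nonneg b a
  · simp

theorem allocProb_le_one (b : Profile n m) (i : Fin n) (j : Fin m) : M.allocProb b i j ≤ 1 :=
  (Finset.single_le_sum (fun i _ => M.allocProb_nonneg b i j) (Finset.mem_univ i)).trans
    (M.sum_allocProb_le b j)

theorem measurable_allocProb (i : Fin n) (j : Fin m) : Measurable fun b => M.allocProb b i j := by
  refine Finset.measurable_fun_sum _ fun a _ => ?_
  split_ifs
  · exact M.measurable_lottery a
  · exact measurable_const

theorem expectedValue_eq (i : Fin n) (v : BidderType m) (b : Profile n m) :
    M.expectedValue i v b = ∑ j, v j * M.allocProb b i j := by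
  simp only [expectedValue, additiveValue, bundle, Finset.sum_filter, allocProb, Finset.mul_sum]
  rw [Finset.sum_comm]
  refine Finset.sum_congr rfl fun j _ => Finset.sum_congr rfl fun a _ => ?_
  split_ifs <;> ring

theorem measurable_update_report (i : Fin n) (r : BidderType m) :
    Measurable fun w : Profile n m => Function.update w i r :=
  (measurable_update_prod (X := fun _ : Fin n => BidderType m) i).comp
    (measurable_id.prodMk measurable_const)

variable [∀ j, IsProbabilityMeasure (F j)]

instance isProbabilityMeasure_typeDist : IsProbabilityMeasure (typeDist F) := by
  unfold typeDist; infer_instance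

instance isProbabilityMeasure_profileDist : IsProbabilityMeasure (profileDist F n) := by
  unfold profileDist; infer_instance

theorem share_le_one (i : Fin n) (j : Fin m) (r : BidderType m) : M.share F i j r ≤ 1 := by
  refine (lintegral_mono fun w => ENNReal.ofReal_le_ofReal (M.allocProb_le_one _ i j)).trans ?_
  simp

theorem measurable_share (i : Fin n) (j : Fin m) : Measurable (M.share F i j) := by
  have := (M.measurable_allocProb i j).comp
    ((measurable_update_prod (X := fun _ : Fin n => BidderType m) i).comp measurable_swap)
  exact Measurable.lintegral_prod_right' (ν := profileDist F n) this.ennreal_ofReal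

theorem integrable_allocProb (i : Fin n) (j : Fin m) (r : BidderType m) :
    Integrable (fun w => M.allocProb (Function.update w i r) i j) (profileDist F n) := by
  refine Integrable.of_bound ((M.measurable_allocProb i j).comp
    (measurable_update_report i r)).aestronglyMeasurable 1
    (Filter.Eventually.of_forall fun w => ?_)
  rw [Real.norm_eq_abs, abs_of_nonneg (M.allocProb_nonneg _ i j)]
  exact M.allocProb_le_one _ i j

theorem integral_allocProb (i : Fin n) (j : Fin m) (r : BidderType m) :
    ∫ w, M.allocProb (Function.update w i r) i j ∂(profileDist F n) = (M.share F i j r).toReal := by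
  rw [integral_eq_lintegral_of_nonneg_ae
    (Filter.Eventually.of_forall fun w => M.allocProb_nonneg _ i j)
    (M.integrable_allocProb F i j r).aestronglyMeasurable]
  rfl

/-! ### Consequences of the incentive constraints -/

variable {M F}

theorem interimUtility_eq (hM : M.HasExpectedPayments F) (i : Fin n) (v : BidderType m)
    {r : BidderType m} (hr : r ∈ typeSpace F) :
    M.interimUtility F i v r =
      ∑ j, v j * (M.share F i j r).toReal - M.interimPayment F i r := by
  have hi : ∀ j, Integrable (fun w => v j * M.allocProb (Function.update w i r) i j)
      (profileDist F n) := fun j => (M.integrable_allocProb F i j r).const_mul _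
  simp only [interimUtility, expectedValue_eq]
  rw [integral_sub (integrable_finsetSum _ fun j _ => hi j) (hM.1 i r hr),
    integral_finsetSum _ fun j _ => hi j]
  simp only [integral_const_mul, integral_allocProb, interimPayment]

/-- Utility from a fixed report is affine in the true type, with the interim shares as slopes.
Incentive compatibility therefore makes the shares a subgradient of the truthful utility. -/
theorem le_interimUtility (hM : M.HasExpectedPayments F) (hB : M.IsBIC F) (i : Fin n)
    {v r : BidderType m} (hv : v ∈ typeSpace F) (hr : r ∈ typeSpace F) :
    M.interimUtility F i r r + ∑ j, (v j - r j) * (M.share F i j r).toReal ≤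
      M.interimUtility F i v v := by
  have h := hB i v hv r hr
  rw [interimUtility_eq hM i v hr] at h
  rw [interimUtility_eq hM i r hr]
  simp only [sub_mul, Finset.sum_sub_distrib]
  linarith

omit [∀ j, IsProbabilityMeasure (F j)] in
theorem update_mem_typeSpace {v : BidderType m} (hv : v ∈ typeSpace F) {j : Fin m} {t : ℝ}
    (ht : t ∈ (F j).support) : Function.update v j t ∈ typeSpace F := by
  intro k
  by_cases hk : k = j
  · subst hk; simpa using ht
  · simpa [Function.update_of_ne hk] using hv k

theorem le_interimUtility_update (hM : M.HasExpectedPayments F) (hB : M.IsBIC F) (i : Fin n)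
    {v : BidderType m} (hv : v ∈ typeSpace F) {j : Fin m} {s t : ℝ} (hs : s ∈ (F j).support)
    (ht : t ∈ (F j).support) :
    M.interimUtility F i (Function.update v j s) (Function.update v j s) +
        (t - s) * (M.share F i j (Function.update v j s)).toReal ≤
      M.interimUtility F i (Function.update v j t) (Function.update v j t) := by
  have h := le_interimUtility hM hB i (update_mem_typeSpace hv ht) (update_mem_typeSpace hv hs)
  rwa [Finset.sum_eq_single j (fun k _ hk => by simp [Function.update_of_ne hk]) (by simp),
    Function.update_self, Function.update_self] at h

/-- The interim probability to get an item is monotone in the value of the item. -/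
theorem share_monotoneOn (hM : M.HasExpectedPayments F) (hB : M.IsBIC F) (i : Fin n)
    {v : BidderType m} (hv : v ∈ typeSpace F) (j : Fin m) :
    MonotoneOn (fun t => M.share F i j (Function.update v j t)) (F j).support := by
  intro s hs t ht hst
  rcases hst.eq_or_lt with rfl | hst
  · exact le_rfl
  -- Adding the two deviations gives (t - s)(share t - share s) ≥ 0.
  have h1 := le_interimUtility_update hM hB i hv hs ht
  have h2 := le_interimUtility_update hM hB i hv ht hs
  have hfin : ∀ r, M.share F i j r ≠ ∞ := fun r =>
    ((M.share_le_one F i j r).trans_lt ENNReal.one_lt_top).ne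
  rw [← ENNReal.toReal_le_toReal (hfin _) (hfin _)]
  nlinarith

/-- The utility of a bidder is at least her information rent from one item. -/
theorem lintegral_share_le (hM : M.HasExpectedPayments F) (hB : M.IsBIC F) (hR : M.IsBIR F)
    (i : Fin n) {v : BidderType m} (hv : v ∈ typeSpace F) {j : Fin m}
    (hoc : (F j).support.OrdConnected) {a : ℝ} (ha : a ∈ (F j).support) :
    ∫⁻ t in Set.Ioo a (v j), M.share F i j (Function.update v j t) ≤
      ENNReal.ofReal (M.interimUtility F i v v) := by
  rcases lt_or_ge (v j) a with hlt | hle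
  · rw [Set.Ioo_eq_empty (not_lt.2 hlt.le)]
    simp
  have hsub : Set.Icc a (v j) ⊆ (F j).support := hoc.out ha (hv j)
  have h1 := integral_le_sub_of_subgradient hle
    (W := fun t => M.interimUtility F i (Function.update v j t) (Function.update v j t))
    (x := fun t => (M.share F i j (Function.update v j t)).toReal)
    fun s hs t ht => le_interimUtility_update hM hB i hv (hsub hs) (hsub ht)
  simp only [Function.update_eq_self] at h1
  -- Individual rationality at the type with value a for item j allows the initial utility to be
  -- dropped.
  have h2 := hR i _ (update_mem_typeSpace hv ha)
  have hm : Measurable fun t => M.share F i j (Function.update v j t) :=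
    (M.measurable_share F i j).comp ((measurable_update_prod (X := fun _ : Fin m => ℝ) j).comp
      (measurable_const.prodMk measurable_id))
  have hfin : ∀ r, M.share F i j r ≠ ∞ := fun r =>
    ((M.share_le_one F i j r).trans_lt ENNReal.one_lt_top).ne
  rw [intervalIntegral.integral_of_le hle, integral_Ioc_eq_integral_Ioo,
    integral_toReal hm.aemeasurable (Filter.Eventually.of_forall fun t => (hfin _).lt_top)] at h1
  have h3 := ENNReal.toReal_nonneg
    (a := ∫⁻ t in Set.Ioo a (v j), M.share F i j (Function.update v j t))
  rw [ENNReal.le_ofReal_iff_toReal_le _ (by linarith)]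
  · linarith
  · refine ((lintegral_mono fun t => M.share_le_one F i j _).trans_lt ?_).ne
    simp

end Mechanism

/-! ### The upper bound -/

section UpperBound

variable {n m : ℕ} (F : Fin m → Measure ℝ)

/-- The type with given quantiles. -/
noncomputable def quantileType (u : Fin m → ℝ) : BidderType m := fun k => quantile (F k) (u k)

theorem quantileType_update (u : Fin m → ℝ) (j : Fin m) (t : ℝ) :
    quantileType F (Function.update u j t) =
      Function.update (quantileType F u) j (quantile (F j) t) := by
  ext k
  by_cases hk : k = j
  · subst hk; simp [quantileType]
  · simp [quantileType, Function.update_of_ne hk]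

variable [∀ j, IsProbabilityMeasure (F j)]

theorem quantileType_mem (h0 : ∀ j, F j (Set.Iio 0) = 0) (u : Fin m → ℝ) :
    quantileType F u ∈ typeSpace F := fun k => quantile_mem_support (h0 k) (u k)

theorem measurePreserving_quantileType :
    MeasurePreserving (quantileType F) (Measure.pi fun _ => uniform) (typeDist F) :=
  measurePreserving_pi (fun _ => uniform) F fun _ => measurePreserving_quantile

/-- The share of item `j` that bidder `i` gets if the quantiles of her values are `u`, but `s` is
her value for item `j`. -/
noncomputable def shareAt (M : Mechanism n m) (i : Fin n) (j : Fin m) (u : Fin m → ℝ) (s : ℝ) :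
    ℝ≥0∞ := M.share F i j (Function.update (quantileType F u) j s)

omit [∀ j, IsProbabilityMeasure (F j)] in
theorem shareAt_quantile (M : Mechanism n m) (i : Fin n) (j : Fin m) (u : Fin m → ℝ) :
    shareAt F M i j u (quantile (F j) (u j)) = M.share F i j (quantileType F u) := by
  rw [shareAt, ← quantileType_update, Function.update_eq_self]

omit [∀ j, IsProbabilityMeasure (F j)] in
theorem shareAt_update (M : Mechanism n m) (i : Fin n) (j : Fin m) (u : Fin m → ℝ) (t : ℝ) :
    shareAt F M i j (Function.update u j t) = shareAt F M i j u := by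
  ext s
  rw [shareAt, shareAt, quantileType_update, Function.update_idem]

theorem measurable_shareAt (M : Mechanism n m) (i : Fin n) (j : Fin m) :
    Measurable fun p : (Fin m → ℝ) × ℝ => shareAt F M i j p.1 p.2 :=
  (M.measurable_share F i j).comp ((measurable_update_prod (X := fun _ : Fin m => ℝ) j).comp
    (((measurePreserving_quantileType F).1.comp measurable_fst).prodMk measurable_snd))

theorem shareAt_le_one (M : Mechanism n m) (i : Fin n) (j : Fin m) (u : Fin m → ℝ) (s : ℝ) :
    shareAt F M i j u s ≤ 1 := M.share_le_one F i j _

theorem shareAt_monotoneOn {M : Mechanism n m} (h0 : ∀ j, F j (Set.Iio 0) = 0)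
    (hM : M.HasExpectedPayments F) (hB : M.IsBIC F) (i : Fin n) (j : Fin m) (u : Fin m → ℝ) :
    MonotoneOn (shareAt F M i j u) (F j).support :=
  Mechanism.share_monotoneOn hM hB i (quantileType_mem F h0 u) j

theorem lintegral_shareAt_le {M : Mechanism n m} (hF : ∀ j, IsRegular (F j))
    (hM : M.HasExpectedPayments F) (hB : M.IsBIC F) (hR : M.IsBIR F) (i : Fin n) (j : Fin m)
    (u : Fin m → ℝ) (l : ℝ) :
    ∫⁻ s in Set.Ioo (quantile (F j) l) (quantile (F j) (u j)), shareAt F M i j u s ≤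
      ENNReal.ofReal (M.interimUtility F i (quantileType F u) (quantileType F u)) :=
  Mechanism.lintegral_share_le hM hB hR i (quantileType_mem F (fun j => (hF j).measure_Iio) u)
    (hF j).support_ordConnected (quantile_mem_support (hF j).measure_Iio l)

attribute [local irreducible] shareAt

/-- A bound for what bidder `i` pays for item `j`, if the item sells as at quantile `t`: her value,
and if it is her favorite item, less the information rent. -/
noncomputable def itemPayment (M : Mechanism n m) (i : Fin n) (j : Fin m) (u : Fin m → ℝ) (t : ℝ) :
    ℝ≥0∞ :=
  ENNReal.ofReal (quantile (F j) t) * shareAt F M i j u (quantile (F j) t) -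
    ∫⁻ s in Set.Ioo (quantile (F j) (othersHighest u j)) (quantile (F j) t), shareAt F M i j u s

/-- A bound for what bidder `i` pays for item `j`. -/
noncomputable def paymentBound (M : Mechanism n m) (i : Fin n) (j : Fin m) (u : Fin m → ℝ) : ℝ≥0∞ :=
  if othersHighest u j < u j then itemPayment F M i j u (u j)
  else ENNReal.ofReal (quantile (F j) (u j)) * M.share F i j (quantileType F u)

/-- The same bound, with payments for favorite items truncated at quantile `c`. -/
noncomputable def truncPaymentBound (M : Mechanism n m) (c : ℝ) (i : Fin n) (j : Fin m)
    (u : Fin m → ℝ) : ℝ≥0∞ :=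
  if othersHighest u j < u j then
    (if othersHighest u j < c then itemPayment F M i j u (min (u j) c) else 0)
  else ENNReal.ofReal (truncQuantile (F j) c (u j)) * M.share F i j (quantileType F u)

theorem measurable_itemPayment (M : Mechanism n m) (i : Fin n) (j : Fin m) :
    Measurable fun p : (Fin m → ℝ) × ℝ => itemPayment F M i j p.1 p.2 := by
  have hQ : Measurable (quantile (F j)) := measurable_quantile
  have hs := measurable_shareAt F M i j
  have h1 : Measurable fun p : (Fin m → ℝ) × ℝ => quantile (F j) (othersHighest p.1 j) :=
    hQ.comp ((measurable_othersHighest j).comp measurable_fst)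
  have h2 : Measurable fun p : (Fin m → ℝ) × ℝ => quantile (F j) p.2 := hQ.comp measurable_snd
  have h3 : Measurable fun p : (Fin m → ℝ) × ℝ => shareAt F M i j p.1 (quantile (F j) p.2) :=
    hs.comp (measurable_fst.prodMk h2)
  have h4 : Measurable (Function.uncurry fun (p : (Fin m → ℝ) × ℝ) s => shareAt F M i j p.1 s) :=
    hs.comp ((measurable_fst.comp measurable_fst).prodMk measurable_snd)
  exact (h2.ennreal_ofReal.mul h3).sub (measurable_lintegral_Ioo h1 h2 h4)

attribute [local irreducible] itemPayment

theorem measurableSet_favorite (j : Fin m) : MeasurableSet {u : Fin m → ℝ | othersHighest u j < u j} :=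
  measurableSet_lt (by fun_prop) (by fun_prop)

theorem measurable_paymentBound (M : Mechanism n m) (i : Fin n) (j : Fin m) :
    Measurable (paymentBound F M i j) := by
  have hQ : Measurable (quantile (F j)) := measurable_quantile
  refine Measurable.ite (measurableSet_favorite j) ?_ (Measurable.mul (by fun_prop)
    ((M.measurable_share F i j).comp (measurePreserving_quantileType F).1))
  exact (measurable_itemPayment F M i j).comp (measurable_id.prodMk (measurable_pi_apply j))

theorem measurable_truncPaymentBound (M : Mechanism n m) (h0 : ∀ j, F j (Set.Iio 0) = 0) {c : ℝ}
    (hc : c ∈ Set.Ioo (0 : ℝ) 1) (i : Fin n) (j : Fin m) :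
    Measurable (truncPaymentBound F M c i j) := by
  have hQ : Measurable (truncQuantile (F j) c) := (truncQuantile_mono (h0 j) hc).measurable
  refine Measurable.ite (measurableSet_favorite j) ?_ (Measurable.mul (by fun_prop)
    ((M.measurable_share F i j).comp (measurePreserving_quantileType F).1))
  refine Measurable.ite (measurableSet_lt (by fun_prop) (by fun_prop)) ?_ measurable_const
  exact (measurable_itemPayment F M i j).comp
    (measurable_id.prodMk ((measurable_pi_apply j).min measurable_const))

/-! ### From payments to the benchmark -/

variable {F}

/-- Payment is value minus utility. Utility is bounded below by the rent from the favorite item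
alone, and this rent is charged to that item. -/
theorem ofReal_interimPayment_le {M : Mechanism n m} (hF : ∀ j, IsRegular (F j))
    (hM : M.HasExpectedPayments F) (hB : M.IsBIC F) (hR : M.IsBIR F) (i : Fin n) (u : Fin m → ℝ) :
    ENNReal.ofReal (M.interimPayment F i (quantileType F u)) ≤ ∑ j, paymentBound F M i j u := by
  have h0 := fun j => (hF j).measure_Iio
  have hv := quantileType_mem F h0 u
  set v := quantileType F u with hvdef
  have hU := hR i v hv
  have heq := Mechanism.interimUtility_eq hM i v hv
  have hnn : ∀ j, 0 ≤ v j * (M.share F i j v).toReal := fun j =>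
    mul_nonneg (quantile_nonneg (h0 j) _) ENNReal.toReal_nonneg
  have hpay : M.interimPayment F i v =
      ∑ j, v j * (M.share F i j v).toReal - M.interimUtility F i v v := by linarith
  have hterm : ∀ j, ENNReal.ofReal (v j * (M.share F i j v).toReal) =
      ENNReal.ofReal (quantile (F j) (u j)) * M.share F i j v := fun j => by
    have hvj : v j = quantile (F j) (u j) := rfl
    rw [hvj, ENNReal.ofReal_mul (quantile_nonneg (h0 j) _), ENNReal.ofReal_toReal
      ((M.share_le_one F i j v).trans_lt ENNReal.one_lt_top).ne]
  rw [hpay, ENNReal.ofReal_sub _ hU, ENNReal.ofReal_sum_of_nonneg fun j _ => hnn j]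
  simp only [hterm]
  by_cases htop : ∃ j, othersHighest u j < u j
  · obtain ⟨j, hj⟩ := htop
    have hrent := lintegral_shareAt_le F hF hM hB hR i j u (othersHighest u j)
    refine (tsub_le_tsub_left hrent _).trans ?_
    rw [← Finset.sum_erase_add _ _ (Finset.mem_univ j),
      ← Finset.sum_erase_add Finset.univ (fun j => paymentBound F M i j u) (Finset.mem_univ j)]
    refine add_tsub_le_assoc.trans (add_le_add (Finset.sum_le_sum fun k hk => ?_) ?_)
    · rw [paymentBound, if_neg]
      exact fun h => Finset.ne_of_mem_erase hk (eq_of_othersHighest_lt h hj)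
    · rw [paymentBound, if_pos hj, itemPayment, shareAt_quantile]
  -- Without a strict favorite the utility is simply dropped.
  · push Not at htop
    refine tsub_le_self.trans (Finset.sum_le_sum fun j _ => ?_)
    rw [paymentBound, if_neg (not_lt.2 (htop j))]

/-- The expected payment of a bidder. -/
theorem payment_le {M : Mechanism n m} (hF : ∀ j, IsRegular (F j))
    (hM : M.HasExpectedPayments F) (hB : M.IsBIC F) (hR : M.IsBIR F) (i : Fin n) :
    ∫⁻ w, ENNReal.ofReal (M.payment w i) ∂(profileDist F n) ≤
      ∫⁻ u, ∑ j, paymentBound F M i j u ∂(Measure.pi fun _ => uniform) +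
      ∫⁻ w, ENNReal.ofReal (-(M.payment w i)) ∂(profileDist F n) := by
  have h0 := fun j => (hF j).measure_Iio
  -- Resampling bidder i's type as a quantile type expresses ex post expectations through interim
  -- ones.
  have key : ∀ g : Profile n m → ℝ≥0∞, Measurable g → ∫⁻ w, g w ∂(profileDist F n) =
      ∫⁻ u, ∫⁻ w, g (Function.update w i (quantileType F u)) ∂(profileDist F n)
        ∂(Measure.pi fun _ => uniform) := by
    intro g hg
    refine (lintegral_pi_update_symm (fun _ : Fin n => typeDist F) i hg).trans ?_
    refine ((measurePreserving_quantileType F).lintegral_comp ?_).symm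
    exact Measurable.lintegral_prod_right' (ν := profileDist F n)
      (hg.comp ((measurable_update_prod (X := fun _ : Fin n => BidderType m) i).comp
        measurable_swap))
  have hp := M.measurable_payment i
  rw [key _ hp.ennreal_ofReal,
    key (fun w => ENNReal.ofReal (-(M.payment w i))) hp.neg.ennreal_ofReal, ← lintegral_add_left
    (Finset.measurable_fun_sum _ fun j _ => measurable_paymentBound F M i j)]
  refine lintegral_mono fun u => ?_
  refine le_trans ?_ (add_le_add_left (ofReal_interimPayment_le hF hM hB hR i u) _)
  have hint := hM.1 i _ (quantileType_mem F h0 u)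
  rw [Mechanism.interimPayment, integral_eq_lintegral_pos_part_sub_lintegral_neg_part hint]
  set P := ∫⁻ w, ENNReal.ofReal (M.payment (Function.update w i (quantileType F u)) i)
    ∂(profileDist F n) with hP
  set N := ∫⁻ w, ENNReal.ofReal (-(M.payment (Function.update w i (quantileType F u)) i))
    ∂(profileDist F n) with hN
  have hPfin : P ≠ ∞ := hint.lintegral_lt_top.ne
  have hNfin : N ≠ ∞ := hint.neg.lintegral_lt_top.ne
  rw [ENNReal.ofReal_sub _ ENNReal.toReal_nonneg, ENNReal.ofReal_toReal hPfin,
    ENNReal.ofReal_toReal hNfin]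
  -- Positive and negative parts stay separate, because the expected payment is not known to be
  -- finite at this point.
  exact le_tsub_add

theorem revenue_le {M : Mechanism n m} (hF : ∀ j, IsRegular (F j))
    (hM : M.HasExpectedPayments F) (hB : M.IsBIC F) (hR : M.IsBIR F) :
    M.revenue F ≤ ((∫⁻ u, ∑ i, ∑ j, paymentBound F M i j u
      ∂(Measure.pi fun _ => uniform) : ℝ≥0∞) : EReal) := by
  rw [lintegral_finsetSum _ fun i _ =>
    Finset.measurable_fun_sum _ fun j _ => measurable_paymentBound F M i j]
  have hcoe : ∀ g : Fin n → ℝ≥0∞, ((∑ i, g i : ℝ≥0∞) : EReal) = ∑ i, (g i : EReal) := fun g =>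
    map_sum (⟨⟨(fun x : ℝ≥0∞ => (x : EReal)), EReal.coe_ennreal_zero⟩,
      EReal.coe_ennreal_add⟩ : ℝ≥0∞ →+ EReal) g Finset.univ
  rw [hcoe, Mechanism.revenue]
  refine Finset.sum_le_sum fun i _ => ?_
  refine EReal.sub_le_of_le_add ?_
  rw [← EReal.coe_ennreal_add, EReal.coe_ennreal_le_coe_ennreal_iff]
  exact payment_le hF hM hB hR i

/-- Fix the quantiles of the other items and let l be the highest of them. Above l, item j is the
favorite, and this is the one-dimensional Myerson bound starting at l. On the rest of the line both
sides coincide. -/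
theorem lintegral_truncPaymentBound_le {M : Mechanism n m} (hF : ∀ j, IsRegular (F j))
    (hM : M.HasExpectedPayments F) (hB : M.IsBIC F) {j : Fin m} {φ : ℝ → ℝ}
    (hφ : IsQuantileVirtualValue (F j) φ) {c : ℝ} (hc : c ∈ Set.Ioo (0 : ℝ) 1) (i : Fin n) :
    ∫⁻ u, truncPaymentBound F M c i j u ∂(Measure.pi fun _ => uniform) ≤
      ∫⁻ u, (ENNReal.ofReal (quantile (F j) c) - benchmarkGap (F j) φ c j u) *
        M.share F i j (quantileType F u) ∂(Measure.pi fun _ => uniform) := by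
  have h0 := fun j => (hF j).measure_Iio
  have hG : Measurable fun u : Fin m → ℝ =>
      (ENNReal.ofReal (quantile (F j) c) - benchmarkGap (F j) φ c j u) *
        M.share F i j (quantileType F u) :=
    (measurable_const.sub (measurable_benchmarkGap (h0 j) hφ hc j)).mul
      ((M.measurable_share F i j).comp (measurePreserving_quantileType F).1)
  rw [lintegral_pi_update (fun _ => uniform) j (measurable_truncPaymentBound F M h0 hc i j),
    lintegral_pi_update (fun _ => uniform) j hG]
  refine lintegral_mono fun u => ?_
  have hitem : ∀ t, itemPayment F M i j (Function.update u j t) = itemPayment F M i j u := by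
    intro t
    ext s
    simp only [itemPayment, shareAt_update, othersHighest_update]
  have hsh : ∀ t, M.share F i j (quantileType F (Function.update u j t)) =
      shareAt F M i j u (quantile (F j) t) := fun t => by
    rw [quantileType_update, shareAt]
  set l := othersHighest u j with hl
  have hl0 : 0 ≤ l := othersHighest_nonneg u j
  simp only [truncPaymentBound, benchmarkGap, othersHighest_update, Function.update_self, hitem,
    hsh, ← hl]
  rw [← lintegral_add_compl _ (measurableSet_Ioi (a := l)),
    ← lintegral_add_compl (fun t => _ * shareAt F M i j u (quantile (F j) t))
      (measurableSet_Ioi (a := l))]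
  refine add_le_add ?_ (le_of_eq ?_)
  · have hleft : ∫⁻ t in Set.Ioi l, (if l < t then if l < c then itemPayment F M i j u (min t c)
        else 0 else ENNReal.ofReal (truncQuantile (F j) c t) *
          shareAt F M i j u (quantile (F j) t)) ∂uniform =
        ∫⁻ t in Set.Ioi l, (if l < c then itemPayment F M i j u (min t c) else 0) ∂uniform :=
      setLIntegral_congr_fun measurableSet_Ioi fun t ht => if_pos (Set.mem_Ioi.1 ht)
    have hright : ∫⁻ t in Set.Ioi l, (ENNReal.ofReal (quantile (F j) c) -
          if l < t then virtualGap (F j) φ c t else valueGap (F j) c t) *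
          shareAt F M i j u (quantile (F j) t) ∂uniform =
        ∫⁻ t in Set.Ioi l, (ENNReal.ofReal (quantile (F j) c) - virtualGap (F j) φ c t) *
          shareAt F M i j u (quantile (F j) t) ∂uniform :=
      setLIntegral_congr_fun measurableSet_Ioi fun t ht => by
        simp only [if_pos (Set.mem_Ioi.1 ht)]
    rw [hleft, hright]
    by_cases hlc : l < c
    · simp only [if_pos hlc, itemPayment, ← hl]
      refine lintegral_payment_le (h0 j) (hF j).support_ordConnected hφ hc hl0 hlc
        ((measurable_shareAt F M i j).comp measurable_prodMk_left)
        (shareAt_le_one F M i j u) (shareAt_monotoneOn F h0 hM hB i j u)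
    · simp only [if_neg hlc, lintegral_zero]
      exact zero_le
  · refine setLIntegral_congr_fun measurableSet_Ioi.compl fun t ht => ?_
    have ht' : ¬ l < t := ht
    simp only [if_neg ht']
    rw [ofReal_sub_valueGap (h0 j) hc]

/-- At each profile, the probabilities that the bidders get item j sum up to at most 1, so a
weighted sum of contributions is at most their maximum. -/
theorem sum_lintegral_benchmark_le {M : Mechanism n m} (hF : ∀ j, IsRegular (F j)) {j : Fin m}
    {φ : ℝ → ℝ} (hφ : IsQuantileVirtualValue (F j) φ) {c : ℝ} (hc : c ∈ Set.Ioo (0 : ℝ) 1) :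
    ∑ i, ∫⁻ u, (ENNReal.ofReal (quantile (F j) c) - benchmarkGap (F j) φ c j u) *
        M.share F i j (quantileType F u) ∂(Measure.pi fun _ => uniform) ≤
      ∫⁻ u : Fin n → Fin m → ℝ,
        ⨆ i, (ENNReal.ofReal (quantile (F j) c) - benchmarkGap (F j) φ c j (u i))
        ∂(Measure.pi fun _ => Measure.pi fun _ => uniform) := by
  have h0 := fun j => (hF j).measure_Iio
  set y : (Fin m → ℝ) → ℝ≥0∞ := fun u =>
    ENNReal.ofReal (quantile (F j) c) - benchmarkGap (F j) φ c j u with hy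
  have hym : Measurable y := measurable_const.sub (measurable_benchmarkGap (h0 j) hφ hc j)
  have hq := measurePreserving_pi (fun _ : Fin n => Measure.pi fun _ : Fin m => uniform)
    (fun _ => typeDist F) (fun _ => measurePreserving_quantileType F)
  set q : (Fin n → Fin m → ℝ) → Profile n m := fun u i => quantileType F (u i) with hqdef
  have hG : ∀ i, Measurable fun u : Fin n → Fin m → ℝ =>
      y (u i) * ENNReal.ofReal (M.allocProb (q u) i j) := fun i =>
    (hym.comp (measurable_pi_apply i)).mul
      ((M.measurable_allocProb i j).comp hq.1).ennreal_ofReal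
  -- The interim share is the allocation probability averaged over the others; undo this averaging
  -- to get one integral over full profiles.
  have h1 : ∀ i, ∫⁻ u, y u * M.share F i j (quantileType F u) ∂(Measure.pi fun _ => uniform) =
      ∫⁻ u : Fin n → Fin m → ℝ, y (u i) * ENNReal.ofReal (M.allocProb (q u) i j)
        ∂(Measure.pi fun _ => Measure.pi fun _ => uniform) := by
    intro i
    rw [lintegral_pi_update_symm (fun _ : Fin n => Measure.pi fun _ : Fin m => uniform) i (hG i)]
    refine lintegral_congr fun v => ?_
    have hupd : ∀ u : Fin n → Fin m → ℝ,
        q (Function.update u i v) = Function.update (q u) i (quantileType F v) := by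
      intro u
      ext i' : 1
      by_cases hi : i' = i
      · subst hi; simp [hqdef]
      · simp [hqdef, Function.update_of_ne hi]
    have hm1 : Measurable fun w : Profile n m =>
        ENNReal.ofReal (M.allocProb (Function.update w i (quantileType F v)) i j) :=
      ((M.measurable_allocProb i j).comp (Mechanism.measurable_update_report i _)).ennreal_ofReal
    simp only [Function.update_self, hupd]
    refine Eq.trans ?_ (lintegral_const_mul _ (hm1.comp hq.1)).symm
    congr 1
    exact (hq.lintegral_comp hm1).symm
  refine (Finset.sum_congr rfl fun i _ => h1 i).trans_le ?_
  rw [← lintegral_finsetSum _ fun i _ => hG i]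
  refine lintegral_mono fun u => ?_
  calc ∑ i, y (u i) * ENNReal.ofReal (M.allocProb (q u) i j)
      ≤ ∑ i, (⨆ i, y (u i)) * ENNReal.ofReal (M.allocProb (q u) i j) :=
        Finset.sum_le_sum fun i _ => by gcongr; exact le_iSup (fun i => y (u i)) i
    _ = (⨆ i, y (u i)) * ENNReal.ofReal (∑ i, M.allocProb (q u) i j) := by
        rw [← Finset.mul_sum, ENNReal.ofReal_sum_of_nonneg fun i _ => M.allocProb_nonneg _ i j]
    _ ≤ (⨆ i, y (u i)) * 1 := by
        gcongr
        exact ENNReal.ofReal_le_one.2 (M.sum_allocProb_le _ j)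
    _ = _ := mul_one _

theorem lintegral_sum_truncPaymentBound_le {M : Mechanism n m} (hn : 1 ≤ n)
    (hF : ∀ j, IsRegular (F j)) (hM : M.HasExpectedPayments F) (hB : M.IsBIC F) {c : ℝ}
    (hc : c ∈ Set.Ioo (0 : ℝ) 1) :
    ∫⁻ u, ∑ i, ∑ j, truncPaymentBound F M c i j u ∂(Measure.pi fun _ => uniform) ≤
      vcgRevenue F (n + (n + 2 * m - 2)) := by
  have h0 := fun j => (hF j).measure_Iio
  rw [vcgRevenue_eq h0 (by omega)]
  have hm := measurable_truncPaymentBound F M h0 hc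
  simp only [Finset.sum_comm (s := (Finset.univ : Finset (Fin n)))]
  rw [lintegral_finsetSum _ fun j _ => Finset.measurable_fun_sum _ fun i _ => hm i j]
  refine Finset.sum_le_sum fun j _ => ?_
  rw [lintegral_finsetSum _ fun i _ => hm i j]
  obtain ⟨φ, hφ⟩ := (hF j).exists_isQuantileVirtualValue
  have hm1 : 1 ≤ m := Fin.pos j
  have : Nontrivial (Fin (n + (n + 2 * m - 2))) := Fin.nontrivial_iff_two_le.2 (by omega)
  calc _ ≤ _ := Finset.sum_le_sum fun i _ => lintegral_truncPaymentBound_le hF hM hB hφ hc i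
    _ ≤ _ := sum_lintegral_benchmark_le hF hφ hc
    _ ≤ _ := lintegral_iSup_benchmark_le hn (h0 j) hφ hc j
    _ ≤ _ := lintegral_truncQuantile_le (h0 j) hc

/-- The truncated bounds agree with the untruncated one as soon as c exceeds all quantiles of the
type. Fatou's lemma then passes to the limit c → 1. -/
theorem lintegral_sum_paymentBound_le {M : Mechanism n m} (hn : 1 ≤ n)
    (hF : ∀ j, IsRegular (F j)) (hM : M.HasExpectedPayments F) (hB : M.IsBIC F) :
    ∫⁻ u, ∑ i, ∑ j, paymentBound F M i j u ∂(Measure.pi fun _ => uniform) ≤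
      vcgRevenue F (n + (n + 2 * m - 2)) := by
  have h0 := fun j => (hF j).measure_Iio
  -- The shift by 2 keeps the truncation quantile in (0, 1) for k = 0 as well.
  set c : ℕ → ℝ := fun k => 1 - 1 / ((k : ℝ) + 2) with hcdef
  have hc : ∀ k, c k ∈ Set.Ioo (0 : ℝ) 1 := fun k => by
    have h1 : (1 : ℝ) / ((k : ℝ) + 2) < 1 := by
      rw [div_lt_one (by positivity)]
      linarith [(Nat.cast_nonneg k : (0 : ℝ) ≤ k)]
    have h2 : (0 : ℝ) < 1 / ((k : ℝ) + 2) := by positivity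
    exact ⟨by simp only [hcdef]; linarith, by simp only [hcdef]; linarith⟩
  have hlim : Filter.Tendsto c Filter.atTop (nhds 1) := by
    have h1 := (tendsto_one_div_add_atTop_nhds_zero_nat (𝕜 := ℝ)).comp
      (Filter.tendsto_add_atTop_nat 1)
    have h2 := h1.const_sub 1
    rw [sub_zero] at h2
    refine h2.congr fun k => ?_
    simp only [Function.comp_apply, hcdef]
    push_cast
    ring
  have hev : ∀ᵐ u : Fin m → ℝ ∂(Measure.pi fun _ => uniform),
      ∑ i, ∑ j, paymentBound F M i j u ≤
        Filter.liminf (fun k => ∑ i, ∑ j, truncPaymentBound F M (c k) i j u) Filter.atTop := by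
    filter_upwards [ae_pi_of_ae (ι := Fin m) ae_uniform] with u hu
    have h1 : ∀ᶠ k in Filter.atTop, ∀ j, u j < c k :=
      Filter.eventually_all.2 fun j => hlim.eventually (lt_mem_nhds (hu j).2)
    have h2 : ∀ᶠ k in Filter.atTop, ∑ i, ∑ j, truncPaymentBound F M (c k) i j u =
        ∑ i, ∑ j, paymentBound F M i j u := by
      filter_upwards [h1] with k hk
      refine Finset.sum_congr rfl fun i _ => Finset.sum_congr rfl fun j _ => ?_
      unfold truncPaymentBound paymentBound
      split_ifs with h3 h4
      · rw [min_eq_left (hk j).le]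
      · exact absurd (h3.trans (hk j)) h4
      · rw [truncQuantile_of_le (hu j).1.le (hk j).le]
    rw [Filter.liminf_congr h2]
    simp
  refine (lintegral_mono_ae hev).trans ((lintegral_liminf_le fun k => ?_).trans ?_)
  · exact Finset.measurable_fun_sum _ fun i _ => Finset.measurable_fun_sum _ fun j _ =>
      measurable_truncPaymentBound F M h0 (hc k) i j
  · refine (Filter.liminf_le_liminf (Filter.Eventually.of_forall fun k =>
      lintegral_sum_truncPaymentBound_le hn hF hM hB (hc k))).trans ?_
    simp

end UpperBound

/-- The optimal revenue is at most the revenue of VCG with `n + 2m - 2` additional bidders. -/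
theorem optRevenue_le {n m : ℕ} (hn : 1 ≤ n) {F : Fin m → Measure ℝ} (hF : ∀ j, IsRegular (F j)) :
    optRevenue F n ≤ ((vcgRevenue F (n + (n + 2 * m - 2)) : ℝ≥0∞) : EReal) := by
  have := fun j => (hF j).isProbabilityMeasure
  refine iSup₂_le fun M ⟨hM, hB, hR⟩ => (revenue_le hF hM hB hR).trans ?_
  rw [EReal.coe_ennreal_le_coe_ennreal_iff]
  exact lintegral_sum_paymentBound_le hn hF hM hB

/-! ### The truncated equal-revenue distribution -/

section EqualRevenue

theorem integral_sq_inv {x y : ℝ} (hx : 0 < x) (hxy : x ≤ y) :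
    ∫ t in x..y, (t ^ 2)⁻¹ = x⁻¹ - y⁻¹ := by
  have h0 : ∀ t ∈ Set.uIcc x y, t ≠ 0 := fun t ht => by
    rw [Set.uIcc_of_le hxy] at ht
    exact (hx.trans_le ht.1).ne'
  rw [intervalIntegral.integral_eq_sub_of_hasDerivAt (f := fun t => -t⁻¹)]
  · ring
  · exact fun t ht => by simpa using! (hasDerivAt_inv (h0 t ht)).neg
  · exact ContinuousOn.intervalIntegrable
      ((continuousOn_id.pow 2).inv₀ fun t ht => pow_ne_zero 2 (h0 t ht))

theorem lintegral_sq_inv {x y : ℝ} (hx : 0 < x) (hxy : x ≤ y) :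
    ∫⁻ t in Set.Icc x y, ENNReal.ofReal (t ^ 2)⁻¹ = ENNReal.ofReal (x⁻¹ - y⁻¹) := by
  rw [← integral_sq_inv hx hxy, intervalIntegral.integral_of_le hxy, ← integral_Icc_eq_integral_Ioc,
    ofReal_integral_eq_lintegral_ofReal]
  · refine ContinuousOn.integrableOn_Icc
      ((continuousOn_id.pow 2).inv₀ fun t ht => pow_ne_zero 2 (hx.trans_le ht.1).ne')
  · exact ae_of_all _ fun t => by positivity

/-- The distribution on `[1, b]` for which every price earns the same revenue. -/
noncomputable def equalRevenue (b : ℝ) : Measure ℝ :=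
  (volume.restrict (Set.Icc 1 b)).withDensity (fun x => ENNReal.ofReal (x ^ 2)⁻¹) +
    ENNReal.ofReal b⁻¹ • Measure.dirac b

variable {b : ℝ}

theorem equalRevenue_apply {s : Set ℝ} (hs : MeasurableSet s) :
    equalRevenue b s = (∫⁻ t in s ∩ Set.Icc 1 b, ENNReal.ofReal (t ^ 2)⁻¹) +
      ENNReal.ofReal b⁻¹ * s.indicator 1 b := by
  rw [equalRevenue, Measure.add_apply, withDensity_apply _ hs, Measure.restrict_restrict hs,
    Measure.smul_apply, Measure.dirac_apply' _ hs, smul_eq_mul]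

theorem equalRevenue_Ici {x : ℝ} (hx : 1 ≤ x) (hxb : x ≤ b) :
    equalRevenue b (Set.Ici x) = ENNReal.ofReal x⁻¹ := by
  have h1 : Set.Ici x ∩ Set.Icc 1 b = Set.Icc x b := by
    ext t
    simp only [Set.mem_inter_iff, Set.mem_Ici, Set.mem_Icc]
    exact ⟨fun h => ⟨h.1, h.2.2⟩, fun h => ⟨h.1, hx.trans h.1, h.2⟩⟩
  have hx0 : 0 < x := by linarith
  rw [equalRevenue_apply measurableSet_Ici, h1, lintegral_sq_inv hx0 hxb,
    Set.indicator_of_mem (show b ∈ Set.Ici x from hxb), Pi.one_apply, mul_one,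
    ← ENNReal.ofReal_add (sub_nonneg.2 (inv_anti₀ hx0 hxb)) (inv_nonneg.2 (hx0.le.trans hxb)),
    sub_add_cancel]

theorem equalRevenue_Iic {x : ℝ} (hx : 1 ≤ x) (hxb : x < b) :
    equalRevenue b (Set.Iic x) = ENNReal.ofReal (1 - x⁻¹) := by
  have h1 : Set.Iic x ∩ Set.Icc 1 b = Set.Icc 1 x := by
    ext t
    simp only [Set.mem_inter_iff, Set.mem_Iic, Set.mem_Icc]
    exact ⟨fun h => ⟨h.2.1, h.1⟩, fun h => ⟨h.2, h.1, h.2.trans hxb.le⟩⟩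
  rw [equalRevenue_apply measurableSet_Iic, h1, lintegral_sq_inv one_pos hx,
    Set.indicator_of_notMem (show b ∉ Set.Iic x from hxb.not_ge), mul_zero, add_zero, inv_one]

theorem equalRevenue_compl (hb : 1 ≤ b) : equalRevenue b (Set.Icc 1 b)ᶜ = 0 := by
  rw [equalRevenue_apply measurableSet_Icc.compl, Set.compl_inter_self]
  simp [hb]

theorem ae_mem_equalRevenue (hb : 1 ≤ b) : ∀ᵐ x ∂equalRevenue b, x ∈ Set.Icc 1 b :=
  equalRevenue_compl hb

theorem isProbabilityMeasure_equalRevenue (hb : 1 ≤ b) :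
    IsProbabilityMeasure (equalRevenue b) := by
  constructor
  rw [← measure_inter_add_sdiff Set.univ (measurableSet_Ici (a := (1 : ℝ))), Set.univ_inter,
    equalRevenue_Ici le_rfl hb, measure_mono_null (fun x hx h => hx.2 h.1) (equalRevenue_compl hb)]
  simp

/-- With density 1/x² and tail 1/x, the virtual value is 0 on [1, b); it jumps to b at the atom. -/
theorem isRegular_equalRevenue (hb : 1 ≤ b) : IsRegular (equalRevenue b) := by
  have := isProbabilityMeasure_equalRevenue hb
  refine ⟨this, Set.Icc 1 b, fun x => (x ^ 2)⁻¹, ENNReal.ofReal b⁻¹, b, Set.ordConnected_Icc,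
    fun x hx => zero_le_one.trans hx.1, by fun_prop,
    fun x hx => inv_pos.2 (pow_pos (one_pos.trans_le hx.1) 2), fun _ => isGreatest_Icc hb, rfl, ?_⟩
  have h1 : ∀ x ∈ Set.Icc 1 b, x < b → virtualValue (equalRevenue b) (fun x => (x ^ 2)⁻¹) x = 0 := by
    intro x hx hxb
    have hx0 : 0 < x := one_pos.trans_le hx.1
    rw [virtualValue, measureReal_def, equalRevenue_Iic hx.1 hxb,
      ENNReal.toReal_ofReal (sub_nonneg.2 (inv_le_one_of_one_le₀ hx.1))]
    field_simp
    ring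
  have h2 : virtualValue (equalRevenue b) (fun x => (x ^ 2)⁻¹) b = b := by
    have h0 : equalRevenue b (Set.Iic b)ᶜ = 0 :=
      measure_mono_null (Set.compl_subset_compl.2 Set.Icc_subset_Iic_self) (equalRevenue_compl hb)
    rw [virtualValue, measureReal_def, (prob_compl_eq_zero_iff measurableSet_Iic).1 h0]
    simp
  intro x hx y hy hxy
  rcases hxy.eq_or_lt with rfl | hxy
  · exact le_rfl
  rw [h1 x hx (hxy.trans_le hy.2)]
  rcases hy.2.eq_or_lt with rfl | hyb
  · rw [h2]
    linarith
  · rw [h1 y hy hyb]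

/-- A posted price x earns x · (1/x) = 1 on [1, b], at most 1 below, and nothing above b. -/
theorem mul_equalRevenue_Ici_le (hb : 1 ≤ b) (x : ℝ) :
    ENNReal.ofReal x * equalRevenue b (Set.Ici x) ≤ 1 := by
  have := isProbabilityMeasure_equalRevenue hb
  rcases le_total x 1 with hx | hx
  · exact mul_le_one' (ENNReal.ofReal_le_one.2 hx) prob_le_one
  rcases le_or_gt x b with hxb | hxb
  · rw [equalRevenue_Ici hx hxb, ← ENNReal.ofReal_mul (by linarith),
      mul_inv_cancel₀ (by linarith), ENNReal.ofReal_one]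
  · have h0 : Set.Ici x ⊆ (Set.Icc 1 b)ᶜ := fun y hy h => (hxb.trans_le hy).not_ge h.2
    rw [measure_mono_null h0 (equalRevenue_compl hb), mul_zero]
    exact zero_le_one

theorem integral_equalRevenue (hb : 1 ≤ b) {g : ℝ → ℝ} (hg : Continuous g) :
    ∫ x, g x ∂equalRevenue b = (∫ x in (1 : ℝ)..b, (x ^ 2)⁻¹ * g x) + b⁻¹ * g b := by
  have := isProbabilityMeasure_equalRevenue hb
  have hc : ContinuousOn (fun x : ℝ => (x ^ 2)⁻¹) (Set.Icc 1 b) :=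
    (continuousOn_id.pow 2).inv₀ fun t ht => pow_ne_zero 2 (one_pos.trans_le ht.1).ne'
  have hm : Measurable fun x : ℝ => ENNReal.ofReal (x ^ 2)⁻¹ := by fun_prop
  have h1 : ∀ x : ℝ, (ENNReal.ofReal (x ^ 2)⁻¹).toReal = (x ^ 2)⁻¹ := fun x =>
    ENNReal.toReal_ofReal (by positivity)
  rw [equalRevenue, integral_add_measure, integral_smul_measure, integral_dirac,
    integral_withDensity_eq_integral_toReal_smul hm (ae_of_all _ fun _ => ENNReal.ofReal_lt_top),
    ENNReal.toReal_ofReal (inv_nonneg.2 (by linarith)), intervalIntegral.integral_of_le hb,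
    ← integral_Icc_eq_integral_Ioc]
  · simp only [h1, smul_eq_mul]
  · rw [integrable_withDensity_iff_integrable_smul' hm (ae_of_all _ fun _ => ENNReal.ofReal_lt_top)]
    simp only [h1, smul_eq_mul]
    exact (hc.mul hg.continuousOn).integrableOn_Icc
  · exact (integrable_dirac (by simp)).smul_measure ENNReal.ofReal_ne_top

theorem memLp_equalRevenue (hb : 1 ≤ b) : MemLp (fun x => x) 2 (equalRevenue b) := by
  have := isProbabilityMeasure_equalRevenue hb
  refine MemLp.of_bound aestronglyMeasurable_id b ?_
  filter_upwards [ae_mem_equalRevenue hb] with x hx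
  rw [Real.norm_eq_abs, abs_of_nonneg (zero_le_one.trans hx.1)]
  exact hx.2

theorem integral_id_equalRevenue (hb : 1 ≤ b) : ∫ x, x ∂equalRevenue b = 1 + Real.log b := by
  have h0 : ∀ t ∈ Set.uIcc 1 b, (t ^ 2)⁻¹ * t = t⁻¹ := fun t ht => by
    rw [Set.uIcc_of_le hb] at ht
    have := (one_pos.trans_le ht.1).ne'
    field_simp
  rw [integral_equalRevenue hb continuous_id', intervalIntegral.integral_congr h0,
    integral_inv_of_pos one_pos (by linarith), inv_mul_cancel₀ (by linarith), div_one, add_comm]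

theorem integral_sq_equalRevenue (hb : 1 ≤ b) : ∫ x, x ^ 2 ∂equalRevenue b = 2 * b - 1 := by
  have h0 : ∀ t ∈ Set.uIcc 1 b, (t ^ 2)⁻¹ * t ^ 2 = 1 := fun t ht => by
    rw [Set.uIcc_of_le hb] at ht
    exact inv_mul_cancel₀ (pow_ne_zero 2 (one_pos.trans_le ht.1).ne')
  have hb0 : b ≠ 0 := by linarith
  rw [integral_equalRevenue hb (by fun_prop), intervalIntegral.integral_congr h0]
  simp only [intervalIntegral.integral_const, smul_eq_mul]
  field_simp
  ring

open ProbabilityTheory in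
/-- With probability at least one half, the value of the grand bundle is at least half its mean. -/
theorem half_le_measure_sum {m : ℕ} (hm : 1 ≤ m) (hl : 4 ≤ 1 + Real.log m) :
    ENNReal.ofReal 2⁻¹ ≤ typeDist (fun _ : Fin m => equalRevenue m)
      {v | m * (1 + Real.log m) / 2 ≤ ∑ j, v j} := by
  have hm' : (1 : ℝ) ≤ m := by exact_mod_cast hm
  have := isProbabilityMeasure_equalRevenue hm'
  have hLp := memLp_equalRevenue hm'
  set P := Measure.pi (fun _ : Fin m => equalRevenue (m : ℝ)) with hP
  have hLp' : ∀ j, MemLp (fun v : Fin m → ℝ => v j) 2 P := fun j =>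
    hLp.comp_measurePreserving (measurePreserving_eval _ j)
  have hmean : ∫ v, (∑ j, fun v : Fin m → ℝ => v j) v ∂P = m * (1 + Real.log m) := by
    simp only [Finset.sum_apply]
    rw [integral_finsetSum _ fun j _ => (hLp' j).integrable one_le_two]
    have : ∀ j : Fin m, ∫ v, v j ∂P = 1 + Real.log m := fun j =>
      (integral_comp_eval (μ := fun _ : Fin m => equalRevenue (m : ℝ)) (i := j)
        (f := fun x => x) aestronglyMeasurable_id).trans (integral_id_equalRevenue hm')
    simp [this, mul_add]
  -- Each variance is at most the second moment 2m - 1, and independence adds up m of them.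
  have hvar : Var[∑ j, fun v : Fin m → ℝ => v j; P] ≤ 2 * m ^ 2 := by
    rw [variance_sum_pi fun _ => hLp]
    have : Var[fun x => x; equalRevenue (m : ℝ)] ≤ 2 * m := by
      refine (variance_le_expectation_sq aestronglyMeasurable_id).trans ?_
      have := integral_sq_equalRevenue hm'
      simp only [Pi.pow_apply]
      refine this.trans_le ?_
      linarith
    calc _ ≤ ∑ _ : Fin m, 2 * (m : ℝ) := Finset.sum_le_sum fun _ _ => this
      _ = 2 * m ^ 2 := by simp; ring
  have hc : 0 < m * (1 + Real.log m) / 2 := by positivity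
  -- Chebyshev with deviation half the mean: 2m² / (m(1 + log m)/2)² = 8/(1 + log m)², which is at
  -- most 1/2 since 1 + log m ≥ 4.
  have h1 := meas_ge_le_variance_div_sq (memLp_finsetSum' Finset.univ fun j _ => hLp' j) hc
  rw [hmean] at h1
  have h2 : P {v | m * (1 + Real.log m) / 2 ≤ ∑ j, v j}ᶜ ≤ ENNReal.ofReal 2⁻¹ := by
    refine (measure_mono fun v hv => ?_).trans (h1.trans (ENNReal.ofReal_le_ofReal ?_))
    · simp only [Set.mem_compl_iff, Set.mem_ofPred_eq, not_le, Finset.sum_apply] at hv ⊢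
      rw [abs_of_neg (by linarith)]
      linarith
    · rw [div_le_iff₀ (by positivity)]
      nlinarith [mul_self_nonneg (m : ℝ), mul_le_mul hl hl (by norm_num) (by linarith)]
  have hs : MeasurableSet {v : Fin m → ℝ | m * (1 + Real.log m) / 2 ≤ ∑ j, v j} :=
    measurableSet_le measurable_const (by fun_prop)
  rw [prob_compl_eq_one_sub hs, tsub_le_iff_left] at h2
  refine ENNReal.le_of_add_le_add_right (a := ENNReal.ofReal 2⁻¹) ENNReal.ofReal_ne_top ?_
  rw [← ENNReal.ofReal_add (by norm_num) (by norm_num)]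
  norm_num at h2 ⊢
  exact h2

end EqualRevenue

/-! ### The lower bound -/

section LowerBound

theorem secondHighest_le_sum {k : ℕ} (hk : 0 < k) {C : Fin k → ℝ} (hC : ∀ i, 0 ≤ C i) :
    ENNReal.ofReal (secondHighest C) ≤ ∑ i, {x | othersHighest C i ≤ x}.indicator
      (fun _ => ENNReal.ofReal (othersHighest C i)) (C i) := by
  have : Nonempty (Fin k) := ⟨⟨0, hk⟩⟩
  obtain ⟨i, hi⟩ := exists_eq_highest hC
  have h1 : othersHighest C i ≤ C i := (othersHighest_le_highest C i).trans (by rw [hi])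
  refine le_trans ?_ (Finset.single_le_sum (fun _ _ => zero_le) (Finset.mem_univ i))
  rw [Set.indicator_of_mem (show C i ∈ {x | othersHighest C i ≤ x} from h1)]
  exact ENNReal.ofReal_le_ofReal (secondHighest_le C i)

/-- The second highest value is what a highest bidder pays when offered the highest value of the
others as a price. Given the others, such a price earns at most 1 from each bidder. -/
theorem lintegral_secondHighest_le {μ : Measure ℝ} [IsProbabilityMeasure μ]
    (h0 : μ (Set.Iio 0) = 0) (hμ : ∀ x, ENNReal.ofReal x * μ (Set.Ici x) ≤ 1) {k : ℕ}
    (hk : 0 < k) :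
    ∫⁻ C : Fin k → ℝ, ENNReal.ofReal (secondHighest C) ∂(Measure.pi fun _ => μ) ≤ k := by
  have hm : ∀ i, Measurable fun C : Fin k → ℝ => {x | othersHighest C i ≤ x}.indicator
      (fun _ => ENNReal.ofReal (othersHighest C i)) (C i) := fun i =>
    Measurable.ite (measurableSet_le (measurable_othersHighest i) (measurable_pi_apply i))
      (measurable_othersHighest i).ennreal_ofReal measurable_const
  have hpos : ∀ᵐ x ∂μ, 0 ≤ x := by
    have : {x : ℝ | ¬ 0 ≤ x} = Set.Iio 0 := by ext; simp
    rw [ae_iff, this, h0]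
  calc _ ≤ ∫⁻ C : Fin k → ℝ, ∑ i, {x | othersHighest C i ≤ x}.indicator
        (fun _ => ENNReal.ofReal (othersHighest C i)) (C i) ∂(Measure.pi fun _ => μ) := by
        refine lintegral_mono_ae ?_
        filter_upwards [ae_pi_of_ae hpos] with C hC using secondHighest_le_sum hk hC
    _ = ∑ i, ∫⁻ C : Fin k → ℝ, {x | othersHighest C i ≤ x}.indicator
        (fun _ => ENNReal.ofReal (othersHighest C i)) (C i) ∂(Measure.pi fun _ => μ) :=
        lintegral_finsetSum _ fun i _ => hm i
    _ ≤ ∑ _ : Fin k, 1 := Finset.sum_le_sum fun i _ => by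
        rw [lintegral_pi_update (fun _ => μ) i (hm i)]
        simp only [othersHighest_update, Function.update_self]
        refine (lintegral_mono fun C => ?_).trans (by simp : ∫⁻ _, 1 ∂_ ≤ 1)
        exact (lintegral_indicator_const measurableSet_Ici _).trans_le (hμ _)
    _ = k := by simp

theorem vcgRevenue_equalRevenue_le {m k : ℕ} (hk : 0 < k) {b : ℝ} (hb : 1 ≤ b) :
    vcgRevenue (fun _ : Fin m => equalRevenue b) k ≤ m * k := by
  have := isProbabilityMeasure_equalRevenue hb
  have h0 := (isRegular_equalRevenue hb).measure_Iio
  rw [vcgRevenue_eq (fun _ => h0) hk]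
  calc _ ≤ ∑ _ : Fin m, (k : ℝ≥0∞) := Finset.sum_le_sum fun _ _ =>
        lintegral_secondHighest_le h0 (mul_equalRevenue_Ici_le hb) hk
    _ = m * k := by simp

/-! ### Selling the grand bundle to one bidder -/

variable {n m : ℕ}

/-- Bidder `i₀` is offered all items together, at price `P`; the others get nothing. -/
noncomputable def bundleSale (i₀ : Fin n) (P : ℝ) : Mechanism n m where
  lottery b := Pi.single (if P ≤ ∑ j, b i₀ j then fun _ => some i₀ else fun _ => none) 1
  payment b i := if i = i₀ ∧ P ≤ ∑ j, b i₀ j then P else 0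
  lottery_mem _ := single_mem_stdSimplex ℝ _
  measurable_lottery a := by
    have hs : MeasurableSet {b : Profile n m | P ≤ ∑ j, b i₀ j} :=
      measurableSet_le measurable_const (by fun_prop)
    simp only [apply_ite (Pi.single (M := fun _ : Allocation n m => ℝ)), ite_apply]
    exact Measurable.ite hs measurable_const measurable_const
  measurable_payment i := by
    by_cases hi : i = i₀
    · simp only [hi, true_and]
      exact Measurable.ite (measurableSet_le measurable_const (by fun_prop)) measurable_const
        measurable_const
    · simp [hi]

theorem bundleSale_expectedValue (i₀ i : Fin n) (P : ℝ) (v : BidderType m) (b : Profile n m) :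
    (bundleSale i₀ P).expectedValue i v b =
      if i = i₀ ∧ P ≤ ∑ j, b i₀ j then ∑ j, v j else 0 := by
  rw [Mechanism.expectedValue, Finset.sum_eq_single
    (if P ≤ ∑ j, b i₀ j then fun _ => some i₀ else fun _ => none)]
  · by_cases h : P ≤ ∑ j, b i₀ j
    · by_cases hi : i = i₀
      · simp [bundleSale, bundle, additiveValue, h, hi]
      · simp [bundleSale, bundle, additiveValue, h, hi, Ne.symm hi]
    · simp [bundleSale, bundle, additiveValue, h]
  · intro a _ ha
    simp [bundleSale, Pi.single_eq_of_ne ha]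
  · simp

variable {F : Fin m → Measure ℝ} [∀ j, IsProbabilityMeasure (F j)]

theorem bundleSale_interimUtility (i₀ i : Fin n) (P : ℝ) (v r : BidderType m) :
    (bundleSale i₀ P).interimUtility F i v r =
      if i = i₀ ∧ P ≤ ∑ j, r j then ∑ j, v j - P else 0 := by
  rw [Mechanism.interimUtility]
  simp only [bundleSale_expectedValue]
  by_cases hi : i = i₀
  · subst hi
    by_cases h : P ≤ ∑ j, r j <;> simp [bundleSale, h]
  · simp [bundleSale, hi]

/-- A posted price for the bundle is incentive compatible and individually rational, and it earns
the price times the probability of sale. -/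
theorem le_optRevenue (i₀ : Fin n) {P : ℝ} (hP : 0 ≤ P) :
    ((ENNReal.ofReal P * typeDist F {v | P ≤ ∑ j, v j} : ℝ≥0∞) : EReal) ≤ optRevenue F n := by
  have hpay : ∀ (w : Profile n m) (i : Fin n), 0 ≤ (bundleSale i₀ P).payment w i := fun w i => by
    simp only [bundleSale]
    split_ifs
    exacts [hP, le_rfl]
  have hneg : ∀ i, ∫⁻ w, ENNReal.ofReal (-((bundleSale i₀ P).payment w i)) ∂(profileDist F n) = 0 :=
    fun i => by
      simp only [fun w => ENNReal.ofReal_of_nonpos (neg_nonpos.2 (hpay w i)), lintegral_zero]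
  have hprop : (bundleSale i₀ P).HasExpectedPayments F ∧ (bundleSale i₀ P).IsBIC F ∧
      (bundleSale i₀ P).IsBIR F := by
    refine ⟨⟨fun i r _ => ?_, fun i => by rw [hneg i]; exact ENNReal.zero_ne_top⟩,
      fun i v _ r _ => ?_, fun i v _ => ?_⟩
    · refine Integrable.of_bound (((bundleSale i₀ P).measurable_payment i).comp
        (Mechanism.measurable_update_report i r)).aestronglyMeasurable P
        (Filter.Eventually.of_forall fun w => ?_)
      rw [Real.norm_eq_abs, abs_of_nonneg (hpay _ i)]
      simp only [bundleSale]
      split_ifs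
      exacts [le_rfl, hP]
    · rw [bundleSale_interimUtility, bundleSale_interimUtility]
      by_cases hi : i = i₀
      · simp only [hi, true_and]
        split_ifs with h1 h2 h2 <;> linarith
      · simp [hi]
    · rw [bundleSale_interimUtility]
      split_ifs with h
      · linarith [h.2]
      · exact le_rfl
  refine le_trans ?_ (le_iSup₂ (f := fun (M : Mechanism n m)
    (_ : M.HasExpectedPayments F ∧ M.IsBIC F ∧ M.IsBIR F) => M.revenue F) _ hprop)
  have hs : MeasurableSet {v : BidderType m | P ≤ ∑ j, v j} :=
    measurableSet_le measurable_const (by fun_prop)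
  have hrev : ∫⁻ w, ENNReal.ofReal ((bundleSale i₀ P).payment w i₀) ∂(profileDist F n) =
      ENNReal.ofReal P * typeDist F {v | P ≤ ∑ j, v j} := by
    have h1 : ∀ w : Profile n m, ENNReal.ofReal ((bundleSale i₀ P).payment w i₀) =
        {v : BidderType m | P ≤ ∑ j, v j}.indicator (fun _ => ENNReal.ofReal P) (w i₀) := fun w => by
      by_cases h : P ≤ ∑ j, w i₀ j <;> simp [bundleSale, h]
    simp only [h1]
    rw [profileDist, (measurePreserving_eval (fun _ : Fin n => typeDist F) i₀).lintegral_comp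
      (f := {v : BidderType m | P ≤ ∑ j, v j}.indicator fun _ => ENNReal.ofReal P)
      (measurable_const.indicator hs), lintegral_indicator_const hs]
  rw [← hrev, Mechanism.revenue]
  simp only [hneg, EReal.coe_ennreal_zero, sub_zero]
  exact Finset.single_le_sum (f := fun i => ((∫⁻ w, ENNReal.ofReal ((bundleSale i₀ P).payment w i)
    ∂(profileDist F n) : ℝ≥0∞) : EReal)) (fun i _ => EReal.coe_ennreal_nonneg _) (Finset.mem_univ i₀)

/-- Bundling earns at least m(1 + log m)/4 and VCG at most m(n + c), so n + c ≥ (1 + log m)/4. As n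
≤ (log m)/8, half of the logarithmic term remains for c. -/
theorem log_le_of_suffices {c : ℕ} (hn : 1 ≤ n) (hm : 1 ≤ m) (hl : 3 ≤ Real.log m)
    (hln : 8 * n ≤ Real.log m) (h : Suffices (regularItems m) n c) : 1 / 8 * Real.log m ≤ c := by
  have hm' : (1 : ℝ) ≤ m := by exact_mod_cast hm
  have := isProbabilityMeasure_equalRevenue hm'
  have hP : 0 ≤ m * (1 + Real.log m) / 2 := by positivity
  have h1 := (le_optRevenue (F := fun _ : Fin m => equalRevenue m) (⟨0, hn⟩ : Fin n) hP).trans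
    (h _ fun _ => isRegular_equalRevenue hm')
  rw [EReal.coe_ennreal_le_coe_ennreal_iff] at h1
  have h2 := (mul_le_mul_right (half_le_measure_sum hm (by linarith)) _).trans
    (h1.trans (vcgRevenue_equalRevenue_le (by omega) hm'))
  rw [← ENNReal.ofReal_mul hP, ← Nat.cast_mul, ← ENNReal.ofReal_natCast,
    ENNReal.ofReal_le_ofReal_iff (Nat.cast_nonneg _)] at h2
  push_cast at h2
  have h3 : (m : ℝ) * ((1 + Real.log m) / 4) ≤ m * (n + c) := by linarith
  have h4 := le_of_mul_le_mul_left h3 (by linarith)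
  linarith

theorem le_competitionComplexity (hn : 1 ≤ n) (hm : 1 ≤ m) (hl : 3 ≤ Real.log m)
    (hln : 8 * n ≤ Real.log m) :
    ENNReal.ofReal (1 / 8 * Real.log m) ≤
      ((competitionComplexity (regularItems m) n : ℕ∞) : ℝ≥0∞) := by
  have h : (⌈1 / 8 * Real.log m⌉₊ : ℕ∞) ≤ competitionComplexity (regularItems m) n :=
    le_iInf₂ fun c hc => Nat.cast_le.2 (Nat.ceil_le.2 (log_le_of_suffices hn hm hl hln hc))
  refine le_trans ?_ (ENat.toENNReal_le.2 h)
  rw [ENat.toENNReal_coe, ← ENNReal.ofReal_natCast]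
  exact ENNReal.ofReal_le_ofReal (Nat.le_ceil _)

end LowerBound

end Auction

theorem mainTheorem1 :
    (∀ n m : ℕ, 1 ≤ n → 1 ≤ m →
      (∀ F : Fin m → Measure ℝ, (∀ j, Auction.IsRegular (F j)) →
        Auction.optRevenue F n ≤
          ((Auction.vcgRevenue F (n + (n + 2 * m - 2)) : ℝ≥0∞) : EReal)) ∧
      Auction.competitionComplexity (Auction.regularItems m) n ≤ ((n + 2 * m - 2 : ℕ) : ℕ∞)) ∧
    (∃ c : ℝ, 0 < c ∧ ∀ n : ℕ, 1 ≤ n → ∀ᶠ m : ℕ in Filter.atTop,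
      ENNReal.ofReal (c * Real.log m) ≤
        ((Auction.competitionComplexity (Auction.regularItems m) n : ℕ∞) : ℝ≥0∞)) := by
  refine ⟨fun n m hn _ => ⟨fun F hF => Auction.optRevenue_le hn hF,
    iInf₂_le _ fun F hF => Auction.optRevenue_le hn hF⟩, 1 / 8, by norm_num, fun n hn => ?_⟩
  have h := Real.tendsto_log_atTop.comp tendsto_natCast_atTop_atTop
  filter_upwards [Filter.eventually_ge_atTop 1, h.eventually_ge_atTop 3,
    h.eventually_ge_atTop (8 * n)] with m hm hl hln
  exact Auction.le_competitionComplexity hn hm hl hln
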